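/- Fix $m\ge 1$ and a measurable space $\mathcal X$. For each $n$ let $X_1,\dots,X_n$ ($X_i=X_{n,i}$) be i.i.d. $\mathcal X$-valued random variables, whose common law may depend on $n$; let $a=a_n:[n]^m\to\mathbb R$ be a weight function and $h=h_n:\mathcal X^m\to\mathbb R$ a measurable kernel, neither assumed symmetric. Let $I_n^m$ be the set of $m$-tuples of pairwise distinct elements of $[n]$, and put $$U_n=\frac{(n-m)!}{n!}\sum_{\boldsymbol i\in I_n^m}a(\boldsymbol i)\,h(X_{i_1},\dots,X_{i_m}),\qquad \sigma_n^2=\mathrm{Var}(U_n),\qquad \theta(\boldsymbol i)=E\,h(X_{i_1},\dots,X_{i_m}).$$ For $i\in[n]$ let $$h_{1,i}(x)=\frac{(n-m)!}{(n-1)!}\sum_{\boldsymbol j}\sum_{l=1}^m a(\pi_l(i;\boldsymbol j))\big\{f^{(l)}_{\boldsymbol j}(x)-\theta(\pi_l(i;\boldsymbol j))\big\},$$ where $\boldsymbol j$ runs over the $(m-1)$-tuples of pairwise distinct elements of $[n]\setminus\{i\}$, $\pi_l(y;\boldsymbol z)$ inserts $y$ at position $l$ of $\boldsymbol z$, and $f^{(l)}_{\boldsymbol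 j}(x)=E\,h(\pi_l(x;Y_1,\dots,Y_{m-1}))$ for independent $Y_k$ distributed as $X_{j_k}$. Let $V(n)=\mathrm{Var}\{n^{-1}\sum_{i=1}^n h_{1,i}(X_i)\}$. Let $A_{K,q}(n)$ be the average of $|a(\boldsymbol i^{(1)})\cdots a(\boldsymbol i^{(K)})|$ over all $K$-tuples of elements of $I_n^m$ whose index sets have at least $q$ elements common to all $K$ (an empty average is $0$). Let $$M_1(n)=\max_{\boldsymbol i,\boldsymbol j\in I_n^m}|\theta(\boldsymbol i)-\theta(\boldsymbol j)|,$$ $$M_2(n)=\max\Big|E\big[E\{h(X_{r_1},\dots,X_{r_m})h(X_{s_1},\dots,X_{s_m})\mid X_{k_p}\}\big]-E\big[E\{h(X_{k_1},\dots,X_{k_m})h(X_{s_1},\dots,X_{s_m})\mid X_{k_p}\}\big]\Big|,$$ the latter maximum being over $p,q\in[m]$ and $\boldsymbol r,\boldsymbol s,\boldsymbol k\in I_n^m$ such that $\boldsymbol r$ and $\boldsymbol s$ have exactly the index $r_p=s_q$ in common and $\boldsymbol k$ and $\boldsymbol s$ have exactly the index $k_p=s_q$ in common (an empty maximum is $0$).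 Given $X_1,\dots,X_n$, let $X_1^*,\dots,X_n^*$ be i.i.d. draws from the empirical distribution of $X_1,\dots,X_n$, let $U_n^*=\frac{(n-m)!}{n!}\sum_{\boldsymbol i\in I_n^m}a(\boldsymbol i)h(X^*_{i_1},\dots,X^*_{i_m})$, and let $\mathrm{Var}^*$ be the conditional variance given $X_1,\dots,X_n$. Assume that $V(n)>0$ for all large $n$, that there are constants $M(n)>0$ with $\max_{\boldsymbol i\in I_n^m}E\{h(X_{i_1},\dots,X_{i_m})^4\}\le M(n)$ for every $n$, and that, as $n\to\infty$, $$n^{-2}V(n)^{-1}A_{2,2}(n)M(n)^{1/2}\to0,\qquad n^{-2}V(n)^{-3/2}A_{3,1}(n)M(n)^{3/4}\to0,$$ $$\limsup_{n\to\infty}\max_{1\le i_1,\dots,i_m\le n}E\{h(X_{i_1},\dots,X_{i_m})^2\}<\infty,\qquad n^{-2}\sigma_n^{-2}A_{2,1}(n)\to0.$$ Then $$\frac1n\sum_{i=1}^n\sum_{j=1}^n\Big\{\frac{h_{1,i}(X_j)}{n\sigma_n}\Big\}^2\xrightarrow{P}1,\qquad \frac1{n^2}\sum_{i=1}^n\Big\{\sum_{j=1}^n\frac{h_{1,i}(X_j)}{n\sigma_n}\Big\}^2\xrightarrow{P}0,$$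 $$n^{-1}\sigma_n^{-2}A_{2,1}(n)\{M_1(n)^2+M_2(n)+n^{-1}\}\to0,$$ and the Efron bootstrap variance estimate is consistent: $$\big|\mathrm{Var}^*(\sigma_n^{-1}U_n^*)-\mathrm{Var}(\sigma_n^{-1}U_n)\big|\xrightarrow{P}0.$$ -/

import Mathlib

open MeasureTheory ProbabilityTheory Filter Topology
open scoped ENNReal Nat

namespace WeightedU

/-! Weighted U-statistics of degree `m = d + 1` (so that `m ≥ 1`), for a fixed sample size `n`.
The indices `1, …, n` are the elements of `Fin n`. -/

section Combinatorics

open scoped Classical in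
/-- The index set `I_n^m` of `m`-tuples from `[n]` without repeated entries. -/
noncomputable def indexSet (m n : ℕ) : Finset (Fin m → Fin n) :=
  Finset.univ.filter fun I => Function.Injective I

open scoped Classical in
/-- The index set `I_{n-1}^{d}(-i)` of `d`-tuples from `[n] \ {i}` without repeated entries. -/
noncomputable def indexSetAvoiding (d : ℕ) {n : ℕ} (i : Fin n) : Finset (Fin d → Fin n) :=
  Finset.univ.filter fun J => Function.Injective J ∧ ∀ k, J k ≠ i

open scoped Classical in
/-- The set of indices that occur in each of the `K` tuples `T 0, …, T (K - 1)`. -/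
noncomputable def commonIndices {K m n : ℕ} (T : Fin K → Fin m → Fin n) : Finset (Fin n) :=
  Finset.univ.filter fun v => ∀ k, v ∈ Set.range (T k)

open scoped Classical in
/-- `(I_n^m)_{≥ q}^{⊗ K}`: the `K`-tuples of elements of `I_n^m` that share at least `q` common
indices. -/
noncomputable def sharingAtLeast (K q m n : ℕ) : Finset (Fin K → Fin m → Fin n) :=
  Finset.univ.filter fun T => (∀ k, T k ∈ indexSet m n) ∧ q ≤ (commonIndices T).card

/-- The average weight `A_{K,q}(n)`. It is `0` if there is no tuple to average over. -/
noncomputable def avgWeight (K q : ℕ) {m n : ℕ} (a : (Fin m → Fin n) → ℝ) : ℝ :=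
  ((sharingAtLeast K q m n).card : ℝ)⁻¹ * ∑ T ∈ sharingAtLeast K q m n, |∏ k, a (T k)|

end Combinatorics

section Statistic

variable {S : Type*}

/-- The weighted U-statistic
`(n-m)!/n! ∑_{I_n^m} a(i₁, …, i_m) h(x_{i₁}, …, x_{i_m})` at the data points `x₁, …, x_n`. -/
noncomputable def uStat {m n : ℕ} (a : (Fin m → Fin n) → ℝ) (h : (Fin m → S) → ℝ)
    (x : Fin n → S) : ℝ :=
  ((n - m)! : ℝ) / (n ! : ℝ) * ∑ I ∈ indexSet m n, a I * h (fun k => x (I k))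

/-- The empirical distribution of the data points `x₁, …, x_n`. -/
noncomputable def empirical [MeasurableSpace S] {n : ℕ} (x : Fin n → S) : Measure S :=
  (n : ℝ≥0∞)⁻¹ • ∑ i, Measure.dirac (x i)

/-- The conditional law, given that the data are `x₁, …, x_n`, of Efron's bootstrap sample
`(X₁*, …, X_n*)`: `n` independent draws from the empirical distribution. -/
noncomputable def bootstrapLaw [MeasurableSpace S] {n : ℕ} (x : Fin n → S) :
    Measure (Fin n → S) :=
  Measure.pi fun _ : Fin n => empirical x

/-- `Var*(g(X₁*, …, X_n*))`, the variance conditional on the data being `x₁, …, x_n`. -/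
noncomputable def bootstrapVar [MeasurableSpace S] {n : ℕ} (g : (Fin n → S) → ℝ)
    (x : Fin n → S) : ℝ :=
  variance g (bootstrapLaw x)

end Statistic

section Population

variable {Ω S : Type*} [MeasurableSpace Ω] [MeasurableSpace S]

/-- The random variable `U_n = U_n(X₁, …, X_n)`. -/
noncomputable def U {m n : ℕ} (a : (Fin m → Fin n) → ℝ) (h : (Fin m → S) → ℝ)
    (X : Fin n → Ω → S) (ω : Ω) : ℝ :=
  uStat a h (fun i => X i ω)

/-- The standard deviation `σ_n` of `U_n`. -/
noncomputable def sigma (μ : Measure Ω) {m n : ℕ} (a : (Fin m → Fin n) → ℝ)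
    (h : (Fin m → S) → ℝ) (X : Fin n → Ω → S) : ℝ :=
  √(variance (U a h X) μ)

/-- `θ(i₁, …, i_m) = E h(X_{i₁}, …, X_{i_m})`. -/
noncomputable def theta (μ : Measure Ω) {m n : ℕ} (h : (Fin m → S) → ℝ) (X : Fin n → Ω → S)
    (I : Fin m → Fin n) : ℝ :=
  ∫ ω, h (fun k => X (I k) ω) ∂μ

/-- `f^{(l)}_{i₁, …, i_{m-1}}(x)`: the integral of `h` with `x` inserted at position `l` and the
other arguments distributed as independent copies of `X_{i₁}, …, X_{i_{m-1}}`. -/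
noncomputable def proj (μ : Measure Ω) {d n : ℕ} (h : (Fin (d + 1) → S) → ℝ)
    (X : Fin n → Ω → S) (l : Fin (d + 1)) (J : Fin d → Fin n) (x : S) : ℝ :=
  ∫ y : Fin d → S, h (Fin.insertNth (α := fun _ => S) l x y)
    ∂(Measure.pi fun k => μ.map (X (J k)))

/-- The first order expansion `h_{1,i;i₁, …, i_{m-1}}(x)`. -/
noncomputable def h1At (μ : Measure Ω) {d n : ℕ} (a : (Fin (d + 1) → Fin n) → ℝ)
    (h : (Fin (d + 1) → S) → ℝ) (X : Fin n → Ω → S) (i : Fin n) (J : Fin d → Fin n)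
    (x : S) : ℝ :=
  ∑ l : Fin (d + 1), a (Fin.insertNth (α := fun _ => Fin n) l i J) *
    (proj μ h X l J x - theta μ h X (Fin.insertNth (α := fun _ => Fin n) l i J))

/-- The first order expansion `h_{1,i}(x)`. -/
noncomputable def h1 (μ : Measure Ω) {d n : ℕ} (a : (Fin (d + 1) → Fin n) → ℝ)
    (h : (Fin (d + 1) → S) → ℝ) (X : Fin n → Ω → S) (i : Fin n) (x : S) : ℝ :=
  ((n - (d + 1))! : ℝ) / ((n - 1)! : ℝ) * ∑ J ∈ indexSetAvoiding d i, h1At μ a h X i J x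

/-- `V(n) = Var(n⁻¹ ∑ᵢ h_{1,i}(X_i))`. -/
noncomputable def V (μ : Measure Ω) {d n : ℕ} (a : (Fin (d + 1) → Fin n) → ℝ)
    (h : (Fin (d + 1) → S) → ℝ) (X : Fin n → Ω → S) : ℝ :=
  variance (fun ω => (n : ℝ)⁻¹ * ∑ i, h1 μ a h X i (X i ω)) μ

/-- `M₁(n)`, the maximal difference of two values of `θ` on `I_n^m`. -/
noncomputable def M1 (μ : Measure Ω) {m n : ℕ} (h : (Fin m → S) → ℝ) (X : Fin n → Ω → S) : ℝ :=
  sSup {v : ℝ | ∃ I ∈ indexSet m n, ∃ J ∈ indexSet m n, v = |theta μ h X I - theta μ h X J|}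

/-- `E[E{h(X_{r₁}, …, X_{r_m}) h(X_{s₁}, …, X_{s_m}) | X_c}]`. -/
noncomputable def meanCondProd (μ : Measure Ω) {m n : ℕ} (h : (Fin m → S) → ℝ)
    (X : Fin n → Ω → S) (r s : Fin m → Fin n) (c : Fin n) : ℝ :=
  ∫ ω, (μ[fun ω' => h (fun k => X (r k) ω') * h (fun k => X (s k) ω') |
    MeasurableSpace.comap (X c) inferInstance]) ω ∂μ

/-- `M₂(n)`: the maximum over positions `p`, `q` and over `r, s, k ∈ I_n^m` such that `r` and `s`
have exactly the index `r_p = s_q` in common, and `k` and `s` exactly the index `k_p = s_q`. -/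
noncomputable def M2 (μ : Measure Ω) {m n : ℕ} (h : (Fin m → S) → ℝ) (X : Fin n → Ω → S) : ℝ :=
  sSup {v : ℝ | ∃ (p q : Fin m), ∃ r ∈ indexSet m n, ∃ s ∈ indexSet m n, ∃ k ∈ indexSet m n,
    (r p = s q ∧ Set.range r ∩ Set.range s = {s q}) ∧
    (k p = s q ∧ Set.range k ∩ Set.range s = {s q}) ∧
    v = |meanCondProd μ h X r s (k p) - meanCondProd μ h X k s (k p)|}

end Population

end WeightedU

/-!
Write `Q` for the common law of the data. Centring the first-order projections of the kernel under
`Q` splits `U_n` into its mean, the linear part `n⁻¹ ∑ᵢ h_{1,i}(X_i)` and a remainder whose kernel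
is conditionally centred given any single argument. Two terms of the remainder are correlated only
if they share two indices, so its variance is at most a constant times `n⁻² A_{2,2} E h²`, which is
negligible compared with `V(n)`; hence `V(n) / σ_n² → 1`. As all `X_i` have the law `Q`, the means
`θ(i₁, …, i_m)` and the expectations compared in `M₂` do not depend on the tuples, so `M₁ = M₂ = 0`.

The `h_{1,i}(X_j)`, `j = 1, …, n`, are i.i.d. and centred, and `n⁻² ∑ᵢ E h_{1,i}(X_1)² = V(n)`. The
average over `j` of `∑ᵢ (h_{1,i}(X_j) / (n σ_n))²` therefore has a mean tending to `1`, and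
its variance is bounded by a Lyapunov-type sum of fourth powers of the weights, which the condition
on `A_{3,1}` sends to `0`. Squaring after summing over `j` instead, orthogonality gives the mean
`V(n) / (n σ_n²)`, which tends to `0`.

For fixed data the bootstrap sample is i.i.d. from the empirical law, so the same decomposition
applies with the empirical law in place of `Q`, and `Var*(U_n*)` is, up to a negligible remainder,
the average above with empirical projections. Replacing these by the projections under `Q` costs
`O(1/n)` times `n⁻¹ σ_n⁻² A_{2,1}`: given one argument, the products of centred kernels at two
tuples of data points integrate to `0` unless the tuples overlap, which a fraction `O(1/n)` of all
pairs do, and for those the second moments of von Mises type give a uniform bound.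
-/

namespace WeightedU

section Counting

open scoped Finset

variable {ι κ α : Type*} [Fintype ι] [Fintype κ] [Fintype α]

lemma card_pow_mul_card_le_of_eqOn_compl {P : Finset ι} {s : Finset (ι → α)}
    (hs : ∀ J ∈ s, ∀ J' ∈ s, (∀ i ∉ P, J i = J' i) → J = J') :
    Fintype.card α ^ #P * #s ≤ Fintype.card α ^ Fintype.card ι := by
  classical
  have hcard : #s ≤ Fintype.card α ^ (Fintype.card ι - #P) := by
    calc #s ≤ Fintype.card ({i // i ∉ P} → α) :=
          Finset.card_le_card_of_injOn (fun J i => J i) (fun _ _ => Finset.mem_univ _)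
            fun J hJ J' hJ' h => hs J hJ J' hJ' fun i hi => congrFun h ⟨i, hi⟩
      _ = _ := by simp [Fintype.card_subtype_compl]
  calc _ ≤ Fintype.card α ^ #P * Fintype.card α ^ (Fintype.card ι - #P) :=
        Nat.mul_le_mul_left _ hcard
    _ = _ := by rw [← pow_add, Nat.add_sub_of_le (Finset.card_le_univ P)]

variable [DecidableEq ι]

open scoped Classical in
lemma card_pow_mul_card_comp_eq_le (p : κ ↪ ι) (v : κ → α) :
    Fintype.card α ^ Fintype.card κ * #{J : ι → α | ∀ k, J (p k) = v k}
      ≤ Fintype.card α ^ Fintype.card ι := by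
  rw [← Finset.card_univ (α := κ), ← Finset.card_map p]
  refine card_pow_mul_card_le_of_eqOn_compl fun J hJ J' hJ' h => funext fun i => ?_
  rw [Finset.mem_filter_univ] at hJ hJ'
  by_cases hi : i ∈ Finset.univ.map p
  · obtain ⟨k, -, rfl⟩ := Finset.mem_map.1 hi
    rw [hJ, hJ']
  · exact h i hi

open scoped Classical in
lemma card_mul_card_apply_eq_le (i : ι) (v : α) :
    Fintype.card α * #{J : ι → α | J i = v} ≤ Fintype.card α ^ Fintype.card ι := by
  simpa using card_pow_mul_card_comp_eq_le
    ⟨fun _ : Unit => i, Function.injective_of_subsingleton _⟩ fun _ => v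

open scoped Classical in
lemma card_mul_card_apply_eq_apply_le {i j : ι} (hij : i ≠ j) :
    Fintype.card α * #{J : ι → α | J i = J j} ≤ Fintype.card α ^ Fintype.card ι := by
  simpa using card_pow_mul_card_le_of_eqOn_compl (P := {i}) (s := {J : ι → α | J i = J j})
    fun J hJ J' hJ' h => funext fun k => by
      rw [Finset.mem_filter_univ] at hJ hJ'
      by_cases hk : k = i
      · rw [hk, hJ, hJ', h j (by simpa using hij.symm)]
      · exact h k (by simpa using hk)

open scoped Classical in
lemma card_mul_card_not_injective_le :
    Fintype.card α * #{J : ι → α | ¬ Function.Injective J}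
      ≤ Fintype.card ι ^ 2 * Fintype.card α ^ Fintype.card ι := by
  have hsub : ({J | ¬ Function.Injective J} : Finset (ι → α)) ⊆
      ({p | p.1 ≠ p.2} : Finset (ι × ι)).biUnion fun p => {J | J p.1 = J p.2} := by
    intro J
    simp only [Function.Injective, Finset.mem_filter_univ, Finset.mem_biUnion, not_forall]
    exact fun ⟨i, j, hJ, hij⟩ => ⟨(i, j), hij, hJ⟩
  calc _ ≤ Fintype.card α * ∑ p : ι × ι with p.1 ≠ p.2, #{J : ι → α | J p.1 = J p.2} := by
        gcongr
        exact (Finset.card_le_card hsub).trans Finset.card_biUnion_le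
    _ ≤ ∑ p : ι × ι with p.1 ≠ p.2, Fintype.card α ^ Fintype.card ι := by
        rw [Finset.mul_sum]
        gcongr with p hp
        exact card_mul_card_apply_eq_apply_le (Finset.mem_filter.1 hp).2
    _ ≤ ∑ _p : ι × ι, Fintype.card α ^ Fintype.card ι :=
        Finset.sum_le_sum_of_subset (Finset.filter_subset _ _)
    _ = _ := by simp [sq]

open scoped Classical in
lemma card_mul_card_not_injective_or_meets_le (L : κ → α) :
    Fintype.card α * #{J : ι → α | ¬ (Function.Injective J ∧ ∀ i k, J i ≠ L k)}
      ≤ (Fintype.card ι ^ 2 + Fintype.card ι * Fintype.card κ) *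
        Fintype.card α ^ Fintype.card ι := by
  have hsub : ({J | ¬ (Function.Injective J ∧ ∀ i k, J i ≠ L k)} : Finset (ι → α)) ⊆
      ({J | ¬ Function.Injective J} : Finset (ι → α)) ∪
        Finset.univ.biUnion fun p : ι × κ => {J | J p.1 = L p.2} := by
    intro J
    simp only [Finset.mem_filter_univ, Finset.mem_union, Finset.mem_biUnion, Finset.mem_univ,
      true_and, not_and_or, not_forall, not_not]
    exact Or.imp_right fun ⟨i, k, h⟩ => ⟨(i, k), h⟩
  calc _ ≤ Fintype.card α * (#{J : ι → α | ¬ Function.Injective J} +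
        ∑ p : ι × κ, #{J : ι → α | J p.1 = L p.2}) := by
        gcongr
        exact (Finset.card_le_card hsub).trans ((Finset.card_union_le _ _).trans
          (Nat.add_le_add_left Finset.card_biUnion_le _))
    _ ≤ Fintype.card ι ^ 2 * Fintype.card α ^ Fintype.card ι +
          ∑ _p : ι × κ, Fintype.card α ^ Fintype.card ι := by
        rw [mul_add, Finset.mul_sum]
        exact add_le_add card_mul_card_not_injective_le
          (Finset.sum_le_sum fun p _ => card_mul_card_apply_eq_le p.1 (L p.2))
    _ = _ := by simp [add_mul]

end Counting

section IndexSets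

open scoped Finset

variable {d m n K q : ℕ}

lemma mem_indexSet {I : Fin m → Fin n} : I ∈ indexSet m n ↔ Function.Injective I := by
  simp [indexSet]

lemma mem_indexSetAvoiding {i : Fin n} {J : Fin d → Fin n} :
    J ∈ indexSetAvoiding d i ↔ Function.Injective J ∧ ∀ k, J k ≠ i := by
  simp [indexSetAvoiding]

lemma mem_commonIndices {T : Fin K → Fin m → Fin n} {v : Fin n} :
    v ∈ commonIndices T ↔ ∀ k, v ∈ Set.range (T k) := by
  simp [commonIndices]

lemma mem_sharingAtLeast {T : Fin K → Fin m → Fin n} :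
    T ∈ sharingAtLeast K q m n ↔ (∀ k, T k ∈ indexSet m n) ∧ q ≤ #(commonIndices T) := by
  simp [sharingAtLeast]

lemma sharingAtLeast_antitone : Antitone fun q => sharingAtLeast K q m n := fun p q hpq T hT => by
  rw [mem_sharingAtLeast] at hT ⊢
  exact hT.imp_right hpq.trans

lemma card_commonIndices_le (hK : 0 < K) (T : Fin K → Fin m → Fin n) : #(commonIndices T) ≤ m := by
  have hsub : commonIndices T ⊆ Finset.univ.image (T ⟨0, hK⟩) := fun v hv => by
    simpa using mem_commonIndices.1 hv ⟨0, hK⟩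
  simpa using (Finset.card_le_card hsub).trans Finset.card_image_le

open scoped Classical in
/-- The elements of `I_n^m` in which every index of `A` occurs. -/
noncomputable def indexSetContaining (m : ℕ) (A : Finset (Fin n)) : Finset (Fin m → Fin n) :=
  {I ∈ indexSet m n | ∀ v ∈ A, v ∈ Set.range I}

lemma mem_indexSetContaining {A : Finset (Fin n)} {I : Fin m → Fin n} :
    I ∈ indexSetContaining m A ↔ I ∈ indexSet m n ∧ ∀ v ∈ A, v ∈ Set.range I := by
  simp [indexSetContaining]

lemma pow_card_mul_card_indexSetContaining_le (A : Finset (Fin n)) :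
    n ^ #A * #(indexSetContaining m A) ≤ m ^ #A * n ^ m := by
  classical
  have hsub : indexSetContaining m A ⊆
      Finset.univ.biUnion fun p : A ↪ Fin m => {I | ∀ v : A, I (p v) = v} := by
    intro I hI
    choose p hp using fun v : A => (mem_indexSetContaining.1 hI).2 v v.2
    have hinj : Function.Injective p := fun v w h => Subtype.ext (by rw [← hp v, h, hp w])
    simpa using ⟨⟨p, hinj⟩, fun v hv => hp ⟨v, hv⟩⟩
  have hfix : ∀ p : A ↪ Fin m, n ^ #A * #{I : Fin m → Fin n | ∀ v : A, I (p v) = v} ≤ n ^ m :=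
    fun p => by simpa using card_pow_mul_card_comp_eq_le p fun v : A => (v : Fin n)
  calc n ^ #A * #(indexSetContaining m A)
      ≤ n ^ #A * ∑ p : A ↪ Fin m, #{I : Fin m → Fin n | ∀ v : A, I (p v) = v} := by
        gcongr
        exact (Finset.card_le_card hsub).trans Finset.card_biUnion_le
    _ ≤ ∑ _p : A ↪ Fin m, n ^ m := by
        rw [Finset.mul_sum]
        gcongr with p
        exact hfix p
    _ = m.descFactorial #A * n ^ m := by simp [Fintype.card_embedding_eq]
    _ ≤ _ := by gcongr; exact Nat.descFactorial_le_pow m _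

lemma pow_mul_card_sharingAtLeast_le (K q m n : ℕ) :
    (n ^ q) ^ K * #(sharingAtLeast K q m n) ≤ n ^ q * (m ^ q * n ^ m) ^ K := by
  classical
  have hsub : sharingAtLeast K q m n ⊆ (Finset.univ.powersetCard q).biUnion
      fun A => Fintype.piFinset fun _ : Fin K => indexSetContaining m A := by
    intro T hT
    obtain ⟨hinj, hcard⟩ := mem_sharingAtLeast.1 hT
    obtain ⟨A, hA, hAq⟩ := Finset.exists_subset_card_eq hcard
    simp only [Finset.mem_biUnion, Finset.mem_powersetCard_univ, Fintype.mem_piFinset,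
      mem_indexSetContaining]
    exact ⟨A, hAq, fun k => ⟨hinj k, fun v hv => mem_commonIndices.1 (hA hv) k⟩⟩
  calc (n ^ q) ^ K * #(sharingAtLeast K q m n)
      ≤ (n ^ q) ^ K * ∑ A ∈ (Finset.univ : Finset (Fin n)).powersetCard q,
          #(indexSetContaining m A) ^ K := by
        gcongr
        refine (Finset.card_le_card hsub).trans (Finset.card_biUnion_le.trans_eq ?_)
        simp
    _ = ∑ A ∈ (Finset.univ : Finset (Fin n)).powersetCard q,
          (n ^ q * #(indexSetContaining m A)) ^ K := by simp [Finset.mul_sum, mul_pow]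
    _ ≤ ∑ _A ∈ (Finset.univ : Finset (Fin n)).powersetCard q, (m ^ q * n ^ m) ^ K := by
        refine Finset.sum_le_sum fun A hA => Nat.pow_le_pow_left ?_ K
        rw [← Finset.mem_powersetCard_univ.1 hA]
        exact pow_card_mul_card_indexSetContaining_le A
    _ = n.choose q * (m ^ q * n ^ m) ^ K := by simp
    _ ≤ _ := by gcongr; exact Nat.choose_le_pow n q

lemma insertNth_injective_iff {α : Type*} {l : Fin (d + 1)} {x : α} {y : Fin d → α} :
    Function.Injective (Fin.insertNth (α := fun _ => α) l x y) ↔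
      Function.Injective y ∧ ∀ k, y k ≠ x := by
  simp only [Function.Injective, Fin.forall_iff_succAbove l, Fin.insertNth_apply_same,
    Fin.insertNth_apply_succAbove, Fin.succAbove_ne, (Fin.succAbove_ne _ _).symm, ne_eq,
    Fin.succAbove_right_inj, eq_comm (a := x), implies_true, imp_false, true_and, forall_and]
  tauto

lemma sum_indexSet_eq_sum_insertNth {E : Type*} [AddCommMonoid E] (l : Fin (d + 1))
    (F : (Fin (d + 1) → Fin n) → E) :
    ∑ I ∈ indexSet (d + 1) n, F I = ∑ i : Fin n, ∑ J ∈ indexSetAvoiding d i,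
      F (Fin.insertNth (α := fun _ => Fin n) l i J) := by
  classical
  simp only [indexSet, indexSetAvoiding, Finset.sum_filter, ← Fintype.sum_prod_type',
    ← insertNth_injective_iff (l := l)]
  exact ((Fin.insertNthEquiv (fun _ => Fin n) l).sum_comp _).symm

end IndexSets

section Weights

open scoped Finset

variable {d m n K q : ℕ}

/-- The normalising factor `(n-m)!/n!` of a U-statistic. -/
noncomputable def normFactor (m n : ℕ) : ℝ := ((n - m)! : ℝ) / (n ! : ℝ)

lemma normFactor_nonneg (m n : ℕ) : 0 ≤ normFactor m n := by
  unfold normFactor; positivity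

lemma pow_le_pow_mul_descFactorial (h : m ≤ n) : n ^ m ≤ m ^ m * n.descFactorial m := by
  rcases Nat.eq_zero_or_pos m with rfl | hm
  · simp
  have hbase : n ≤ m * (n + 1 - m) := by
    obtain ⟨k, rfl⟩ := Nat.exists_eq_add_of_le h
    rw [show m + k + 1 - m = k + 1 by omega]
    nlinarith
  calc n ^ m ≤ (m * (n + 1 - m)) ^ m := Nat.pow_le_pow_left hbase m
    _ = m ^ m * (n + 1 - m) ^ m := mul_pow _ _ _
    _ ≤ _ := Nat.mul_le_mul_left _ (Nat.pow_sub_le_descFactorial n m)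

lemma normFactor_mul_pow_le (h : m ≤ n) : normFactor m n * (n : ℝ) ^ m ≤ (m : ℝ) ^ m := by
  have hfact : (n ! : ℝ) = (n - m)! * n.descFactorial m := by
    exact_mod_cast (Nat.factorial_mul_descFactorial h).symm
  have hpow : (n : ℝ) ^ m ≤ (m : ℝ) ^ m * n.descFactorial m := by
    exact_mod_cast pow_le_pow_mul_descFactorial h
  rw [normFactor, div_mul_eq_mul_div, div_le_iff₀ (by positivity), hfact]
  calc ((n - m)! : ℝ) * n ^ m ≤ (n - m)! * (m ^ m * n.descFactorial m) := by gcongr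
    _ = _ := by ring

lemma avgWeight_nonneg (K q : ℕ) (a : (Fin m → Fin n) → ℝ) : 0 ≤ avgWeight K q a := by
  unfold avgWeight; positivity

/-- The sum of `|a(i⁽¹⁾) ⋯ a(i⁽ᴷ⁾)|` over the `K`-tuples of elements of `I_n^m` that share at least
`q` indices, with each of the `K` factors normalised as in the U-statistic. -/
noncomputable def sharedWeight (K q : ℕ) (a : (Fin m → Fin n) → ℝ) : ℝ :=
  normFactor m n ^ K * ∑ T ∈ sharingAtLeast K q m n, |∏ k, a (T k)|

lemma sharedWeight_nonneg (K q : ℕ) (a : (Fin m → Fin n) → ℝ) : 0 ≤ sharedWeight K q a :=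
  mul_nonneg (pow_nonneg (normFactor_nonneg m n) K) (Finset.sum_nonneg fun _ _ => abs_nonneg _)

lemma sharedWeight_antitone (a : (Fin m → Fin n) → ℝ) : Antitone fun q => sharedWeight K q a :=
  fun _ _ hpq => mul_le_mul_of_nonneg_left
    (Finset.sum_le_sum_of_subset_of_nonneg (sharingAtLeast_antitone hpq) fun _ _ _ => abs_nonneg _)
    (pow_nonneg (normFactor_nonneg m n) K)

lemma sharedWeight_eq (K q : ℕ) (a : (Fin m → Fin n) → ℝ) :
    sharedWeight K q a = normFactor m n ^ K * #(sharingAtLeast K q m n) * avgWeight K q a := by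
  rw [sharedWeight, avgWeight, mul_assoc]
  rcases (sharingAtLeast K q m n).eq_empty_or_nonempty with h | h
  · simp [h]
  · rw [mul_inv_cancel_left₀ (by exact_mod_cast h.card_pos.ne')]

lemma pow_mul_sharedWeight_le (hmn : m ≤ n) (a : (Fin m → Fin n) → ℝ) :
    ((n : ℝ) ^ q) ^ K * sharedWeight K q a ≤
      (n : ℝ) ^ q * (((m : ℝ) ^ (m + q)) ^ K * avgWeight K q a) := by
  have hA := avgWeight_nonneg K q a
  have hν := normFactor_nonneg m n
  have hcard : ((n : ℝ) ^ q) ^ K * #(sharingAtLeast K q m n) ≤ n ^ q * (m ^ q * n ^ m) ^ K := by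
    exact_mod_cast pow_mul_card_sharingAtLeast_le K q m n
  calc ((n : ℝ) ^ q) ^ K * sharedWeight K q a
      = normFactor m n ^ K * (((n : ℝ) ^ q) ^ K * #(sharingAtLeast K q m n)) *
          avgWeight K q a := by rw [sharedWeight_eq]; ring
    _ ≤ normFactor m n ^ K * (n ^ q * (m ^ q * n ^ m) ^ K) * avgWeight K q a := by gcongr
    _ = n ^ q * ((m ^ q * (normFactor m n * n ^ m)) ^ K * avgWeight K q a) := by
        simp only [mul_pow]; ring
    _ ≤ n ^ q * ((m ^ q * m ^ m) ^ K * avgWeight K q a) := by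
        gcongr; exact normFactor_mul_pow_le hmn
    _ = _ := by rw [← pow_add, add_comm q m]

lemma sharedWeight_two_two_le (hn : 0 < n) (hmn : m ≤ n) (a : (Fin m → Fin n) → ℝ) :
    sharedWeight 2 2 a ≤ ((m : ℝ) ^ (m + 2)) ^ 2 * (((n : ℝ) ^ 2)⁻¹ * avgWeight 2 2 a) := by
  have : (0 : ℝ) < n := by exact_mod_cast hn
  have h := pow_mul_sharedWeight_le (K := 2) (q := 2) hmn a
  calc sharedWeight 2 2 a = (((n : ℝ) ^ 2) ^ 2)⁻¹ * (((n : ℝ) ^ 2) ^ 2 * sharedWeight 2 2 a) := by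
        field_simp
    _ ≤ (((n : ℝ) ^ 2) ^ 2)⁻¹ *
          ((n : ℝ) ^ 2 * (((m : ℝ) ^ (m + 2)) ^ 2 * avgWeight 2 2 a)) := by gcongr
    _ = _ := by field_simp

lemma sharedWeight_two_two_le_avgWeight_two_one (hn : 0 < n) (hmn : m ≤ n)
    (a : (Fin m → Fin n) → ℝ) :
    sharedWeight 2 2 a ≤ ((m : ℝ) ^ (m + 1)) ^ 2 * ((n : ℝ)⁻¹ * avgWeight 2 1 a) := by
  have : (0 : ℝ) < n := by exact_mod_cast hn
  have h := pow_mul_sharedWeight_le (K := 2) (q := 1) hmn a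
  calc sharedWeight 2 2 a ≤ sharedWeight 2 1 a := sharedWeight_antitone a one_le_two
    _ = (((n : ℝ) ^ 1) ^ 2)⁻¹ * (((n : ℝ) ^ 1) ^ 2 * sharedWeight 2 1 a) := by field_simp
    _ ≤ (((n : ℝ) ^ 1) ^ 2)⁻¹ *
          ((n : ℝ) ^ 1 * (((m : ℝ) ^ (m + 1)) ^ 2 * avgWeight 2 1 a)) := by gcongr
    _ = _ := by field_simp

/-- The total absolute weight of the tuples that contain the index `i`, normalised like `h1`. It
dominates every `weightCoef a l i`. -/
noncomputable def absWeight (a : (Fin m → Fin n) → ℝ) (i : Fin n) : ℝ :=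
  n * normFactor m n * ∑ I ∈ indexSetContaining m {i}, |a I|

lemma absWeight_nonneg (a : (Fin m → Fin n) → ℝ) (i : Fin n) : 0 ≤ absWeight a i := by
  have := normFactor_nonneg m n
  unfold absWeight; positivity

open scoped Classical in
lemma sum_indexSetContaining_pow (a : (Fin m → Fin n) → ℝ) (i : Fin n) :
    (∑ I ∈ indexSetContaining m {i}, |a I|) ^ K =
      ∑ T ∈ sharingAtLeast K 1 m n with i ∈ commonIndices T, |∏ k, a (T k)| := by
  rw [Finset.sum_pow']
  refine Finset.sum_congr (Finset.ext fun T => ?_) fun T _ => (Finset.abs_prod _ _).symm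
  simp only [Fintype.mem_piFinset, mem_indexSetContaining, Finset.mem_singleton, forall_eq,
    Finset.mem_filter, mem_sharingAtLeast, mem_commonIndices, forall_and]
  exact ⟨fun ⟨hT, hi⟩ => ⟨⟨hT, Finset.card_pos.2 ⟨i, mem_commonIndices.2 hi⟩⟩, hi⟩,
    fun h => ⟨h.1.1, h.2⟩⟩

lemma sum_absWeight_pow_le (hK : 0 < K) (hmn : m ≤ n) (a : (Fin m → Fin n) → ℝ) :
    ∑ i, absWeight a i ^ K ≤ m * ((m : ℝ) ^ (m + 1)) ^ K * (n * avgWeight K 1 a) := by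
  classical
  have hν := normFactor_nonneg m n
  calc ∑ i, absWeight a i ^ K
      = (n * normFactor m n) ^ K *
          ∑ T ∈ sharingAtLeast K 1 m n, #(commonIndices T) * |∏ k, a (T k)| := by
        simp_rw [absWeight, mul_pow _ (∑ _ ∈ _, _), sum_indexSetContaining_pow,
          ← Finset.mul_sum, Finset.sum_filter]
        rw [Finset.sum_comm]
        simp
    _ ≤ (n * normFactor m n) ^ K * ∑ T ∈ sharingAtLeast K 1 m n, m * |∏ k, a (T k)| := by
        gcongr with T
        exact_mod_cast card_commonIndices_le hK T
    _ = m * (((n : ℝ) ^ 1) ^ K * sharedWeight K 1 a) := by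
        rw [sharedWeight, ← Finset.mul_sum, pow_one, mul_pow]; ring
    _ ≤ m * ((n : ℝ) ^ 1 * (((m : ℝ) ^ (m + 1)) ^ K * avgWeight K 1 a)) := by
        exact mul_le_mul_of_nonneg_left (pow_mul_sharedWeight_le hmn a) (by positivity)
    _ = _ := by ring

/-- The total weight of the tuples whose entry at position `l` is `i`, normalised as in `h1`: the
first order expansion `h1` is `∑ l, weightCoef a l i * proj l`. -/
noncomputable def weightCoef (a : (Fin (d + 1) → Fin n) → ℝ) (l : Fin (d + 1)) (i : Fin n) : ℝ :=
  ((n - (d + 1))! : ℝ) / ((n - 1)! : ℝ) *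
    ∑ J ∈ indexSetAvoiding d i, a (Fin.insertNth (α := fun _ => Fin n) l i J)

lemma weightCoef_eq (a : (Fin (d + 1) → Fin n) → ℝ) (l : Fin (d + 1)) (i : Fin n) :
    weightCoef a l i = n * normFactor (d + 1) n *
      ∑ J ∈ indexSetAvoiding d i, a (Fin.insertNth (α := fun _ => Fin n) l i J) := by
  have hn : (n : ℝ) ≠ 0 := by exact_mod_cast i.pos.ne'
  have hfact : (n ! : ℝ) = n * (n - 1)! := by exact_mod_cast (Nat.mul_factorial_pred i.pos.ne').symm
  rw [weightCoef, normFactor, hfact]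
  field_simp

lemma abs_weightCoef_le (a : (Fin (d + 1) → Fin n) → ℝ) (l : Fin (d + 1)) (i : Fin n) :
    |weightCoef a l i| ≤ absWeight a i := by
  classical
  have hν := normFactor_nonneg (d + 1) n
  have hsub : (indexSetAvoiding d i).image (Fin.insertNth (α := fun _ => Fin n) l i) ⊆
      indexSetContaining (d + 1) {i} := by
    intro I hI
    obtain ⟨J, hJ, rfl⟩ := Finset.mem_image.1 hI
    simp only [mem_indexSetContaining, mem_indexSet, insertNth_injective_iff,
      ← mem_indexSetAvoiding, Finset.mem_singleton, forall_eq]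
    exact ⟨hJ, l, by simp⟩
  rw [weightCoef_eq, abs_mul, abs_of_nonneg (by positivity)]
  refine mul_le_mul_of_nonneg_left ?_ (by positivity)
  calc _ ≤ ∑ J ∈ indexSetAvoiding d i, |a (Fin.insertNth (α := fun _ => Fin n) l i J)| :=
        Finset.abs_sum_le_sum_abs _ _
    _ = ∑ I ∈ (indexSetAvoiding d i).image (Fin.insertNth (α := fun _ => Fin n) l i), |a I| :=
        (Finset.sum_image (f := fun I => |a I|)
          (Fin.insertNth_right_injective (α := fun _ => Fin n) (p := l) i).injOn).symm
    _ ≤ _ := Finset.sum_le_sum_of_subset_of_nonneg hsub fun _ _ _ => abs_nonneg _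

lemma sum_weightCoef_sq_le (a : (Fin (d + 1) → Fin n) → ℝ) (i : Fin n) :
    ∑ l, weightCoef a l i ^ 2 ≤ ((d : ℝ) + 1) * absWeight a i ^ 2 := by
  calc ∑ l, weightCoef a l i ^ 2 ≤ ∑ _l : Fin (d + 1), absWeight a i ^ 2 := by
        exact Finset.sum_le_sum fun l _ =>
          sq_le_sq.2 ((abs_weightCoef_le a l i).trans (le_abs_self _))
    _ = _ := by simp

lemma normFactor_mul_sum_weighted_sum_eq (a : (Fin (d + 1) → Fin n) → ℝ)
    (w : Fin (d + 1) → Fin n → ℝ) :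
    normFactor (d + 1) n * ∑ I ∈ indexSet (d + 1) n, a I * ∑ l, w l (I l) =
      (n : ℝ)⁻¹ * ∑ i, ∑ l, weightCoef a l i * w l i := by
  have hsplit : ∑ I ∈ indexSet (d + 1) n, a I * ∑ l, w l (I l) =
      ∑ i, ∑ l, (∑ J ∈ indexSetAvoiding d i,
        a (Fin.insertNth (α := fun _ => Fin n) l i J)) * w l i := by
    simp_rw [Finset.mul_sum]
    rw [Finset.sum_comm, Finset.sum_comm (t := Finset.univ (α := Fin (d + 1)))]
    refine Finset.sum_congr rfl fun l _ => ?_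
    rw [sum_indexSet_eq_sum_insertNth l]
    simp [Finset.sum_mul]
  rw [hsplit, Finset.mul_sum, Finset.mul_sum]
  refine Finset.sum_congr rfl fun i _ => ?_
  have hn : (n : ℝ) ≠ 0 := by exact_mod_cast i.pos.ne'
  simp_rw [weightCoef_eq, Finset.mul_sum]
  refine Finset.sum_congr rfl fun l _ => ?_
  rw [← Finset.mul_sum]
  field_simp

end Weights

section MomentBounds

open scoped NNReal

variable {α β E : Type*} [MeasurableSpace α] [MeasurableSpace β] [NormedAddCommGroup E]
  [NormedSpace ℝ E] {μ : Measure α} {ν : Measure β} {p : ℝ≥0∞} {k : ℕ}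

lemma integral_comp_of_measurePreserving {T : α → β} (hT : MeasurePreserving T μ ν) {f : β → E}
    (hf : AEStronglyMeasurable f ν) : ∫ x, f (T x) ∂μ = ∫ y, f y ∂ν := by
  rw [← hT.map_eq, integral_map hT.aemeasurable (by rwa [hT.map_eq])]

lemma enorm_integral_le_eLpNorm [IsProbabilityMeasure μ] {f : α → E}
    (hf : AEStronglyMeasurable f μ) (hp : 1 ≤ p) : ‖∫ x, f x ∂μ‖ₑ ≤ eLpNorm f p μ := by
  refine (enorm_integral_le_lintegral_enorm f).trans ?_
  rw [← eLpNorm_one_eq_lintegral_enorm]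
  exact eLpNorm_le_eLpNorm_of_exponent_le hp hf

lemma eLpNorm_integral_prod_left_le [IsProbabilityMeasure ν] {f : α × β → E}
    (hf : AEStronglyMeasurable f (μ.prod ν)) (hp : 1 ≤ p) :
    eLpNorm (fun x => ∫ y, f (x, y) ∂ν) p μ ≤ eLpNorm f p (μ.prod ν) := by
  rcases eq_or_ne p ∞ with rfl | hp'
  · simp only [eLpNorm_exponent_top]
    refine eLpNormEssSup_le_of_ae_enorm_bound ?_
    filter_upwards [Measure.ae_ae_of_ae_prod (enorm_ae_le_eLpNormEssSup f (μ.prod ν))] with x hx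
    refine (enorm_integral_le_lintegral_enorm _).trans ((lintegral_mono_ae hx).trans_eq ?_)
    simp
  have hp0 : p ≠ 0 := (zero_lt_one.trans_le hp).ne'
  have hpr : 0 < p.toReal := ENNReal.toReal_pos hp0 hp'
  rw [eLpNorm_eq_lintegral_rpow_enorm_toReal hp0 hp',
    eLpNorm_eq_lintegral_rpow_enorm_toReal hp0 hp', lintegral_prod _ (hf.enorm.pow_const _)]
  refine ENNReal.rpow_le_rpow (lintegral_mono_ae ?_) (by positivity)
  filter_upwards [hf.prodMk_left] with x hx
  rw [← ENNReal.le_rpow_inv_iff hpr, ← one_div, ← eLpNorm_eq_lintegral_rpow_enorm_toReal hp0 hp']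
  exact enorm_integral_le_eLpNorm hx hp

lemma integral_pow_eq_toReal_eLpNorm_pow {f : α → ℝ} (hf : AEStronglyMeasurable f μ) (hk : Even k)
    (hk0 : k ≠ 0) : ∫ x, f x ^ k ∂μ = (eLpNorm f k μ).toReal ^ k := by
  have hpow := eLpNorm_nnreal_pow_eq_lintegral (μ := μ) (f := f) (p := (k : ℝ≥0))
    (by exact_mod_cast hk0)
  simp only [NNReal.coe_natCast, ENNReal.rpow_natCast, ENNReal.coe_natCast] at hpow
  rw [integral_eq_lintegral_of_nonneg_ae (ae_of_all _ fun x => hk.pow_nonneg _) (hf.pow k),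
    ← ENNReal.toReal_pow, hpow]
  congr 1
  refine lintegral_congr fun x => ?_
  rw [← hk.pow_abs, ENNReal.ofReal_pow (abs_nonneg _), Real.enorm_eq_ofReal_abs]

lemma integral_pow_le_of_eLpNorm_le {f : α → ℝ} {g : β → ℝ} {C : ℝ≥0}
    (hf : AEStronglyMeasurable f μ) (hg : MemLp g k ν)
    (hfg : eLpNorm f k μ ≤ C * eLpNorm g k ν) (hk : Even k) (hk0 : k ≠ 0) :
    ∫ x, f x ^ k ∂μ ≤ (C : ℝ) ^ k * ∫ y, g y ^ k ∂ν := by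
  rw [integral_pow_eq_toReal_eLpNorm_pow hf hk hk0, integral_pow_eq_toReal_eLpNorm_pow hg.1 hk hk0,
    ← mul_pow]
  refine pow_le_pow_left₀ ENNReal.toReal_nonneg ?_ k
  simpa using ENNReal.toReal_mono (ENNReal.mul_ne_top ENNReal.coe_ne_top hg.eLpNorm_ne_top) hfg

lemma integrable_pow_of_memLp {f : α → ℝ} (hf : MemLp f k μ) (hk : k ≠ 0) :
    Integrable (fun x => f x ^ k) μ :=
  (integrable_norm_iff (hf.1.pow k)).1 (by simpa using hf.integrable_norm_pow hk)

end MomentBounds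

section Kernel

variable {S : Type*} [MeasurableSpace S] {d : ℕ}

/-- The conditional mean of `h` given that its argument at position `l` is `x`, when the other
arguments are independent draws from `Q`. -/
noncomputable def condKernel (Q : Measure S) (h : (Fin (d + 1) → S) → ℝ) (l : Fin (d + 1))
    (x : S) : ℝ :=
  ∫ y : Fin d → S, h (Fin.insertNth (α := fun _ => S) l x y) ∂(Measure.pi fun _ => Q)

/-- The mean of `h` at independent draws from `Q`. -/
noncomputable def meanKernel (Q : Measure S) {m : ℕ} (h : (Fin m → S) → ℝ) : ℝ :=
  ∫ z, h z ∂(Measure.pi fun _ => Q)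

/-- The first order Hoeffding projection of `h` at position `l`. -/
noncomputable def projKernel (Q : Measure S) (h : (Fin (d + 1) → S) → ℝ) (l : Fin (d + 1))
    (x : S) : ℝ :=
  condKernel Q h l x - meanKernel Q h

/-- The degenerate part of `h`, that is the sum of its Hoeffding projections of order at least
two. -/
noncomputable def degKernel (Q : Measure S) (h : (Fin (d + 1) → S) → ℝ)
    (z : Fin (d + 1) → S) : ℝ :=
  h z - meanKernel Q h - ∑ l, projKernel Q h l (z l)

variable {h : (Fin (d + 1) → S) → ℝ} {Q : Measure S} {p : ℝ≥0∞}

lemma measurable_insertNth (l : Fin (d + 1)) :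
    Measurable fun p : S × (Fin d → S) => Fin.insertNth (α := fun _ => S) l p.1 p.2 :=
  (MeasurableEquiv.piFinSuccAbove (fun _ => S) l).symm.measurable

lemma degKernel_insertNth (l : Fin (d + 1)) (x : S) (y : Fin d → S) :
    degKernel Q h (Fin.insertNth (α := fun _ => S) l x y) =
      h (Fin.insertNth (α := fun _ => S) l x y) - condKernel Q h l x -
        ∑ k : Fin d, projKernel Q h (l.succAbove k) (y k) := by
  rw [degKernel, Fin.sum_univ_succAbove _ l]
  simp only [Fin.insertNth_apply_same, Fin.insertNth_apply_succAbove, projKernel]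
  ring

variable [IsProbabilityMeasure Q]

lemma measurePreserving_insertNth (l : Fin (d + 1)) :
    MeasurePreserving (fun p : S × (Fin d → S) => Fin.insertNth (α := fun _ => S) l p.1 p.2)
      (Q.prod (Measure.pi fun _ => Q)) (Measure.pi fun _ => Q) :=
  (measurePreserving_piFinSuccAbove (fun _ : Fin (d + 1) => Q) l).symm _

lemma measurable_condKernel (hh : Measurable h) (l : Fin (d + 1)) :
    Measurable (condKernel Q h l) :=
  ((hh.comp (measurable_insertNth l)).stronglyMeasurable.integral_prod_right'
    (ν := Measure.pi fun _ => Q)).measurable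

lemma measurable_projKernel (hh : Measurable h) (l : Fin (d + 1)) :
    Measurable (projKernel Q h l) :=
  (measurable_condKernel hh l).sub_const _

lemma measurable_degKernel (hh : Measurable h) : Measurable (degKernel Q h) := by
  have := fun l => measurable_projKernel (Q := Q) hh l
  unfold degKernel
  fun_prop

lemma eLpNorm_condKernel_le (hh : Measurable h) (hp : 1 ≤ p) (l : Fin (d + 1)) :
    eLpNorm (condKernel Q h l) p Q ≤ eLpNorm h p (Measure.pi fun _ => Q) :=
  (eLpNorm_integral_prod_left_le
    (hh.comp (measurable_insertNth l)).aestronglyMeasurable hp).trans_eq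
    (eLpNorm_comp_measurePreserving (g := h) hh.aestronglyMeasurable
      (measurePreserving_insertNth l))

lemma eLpNorm_const_meanKernel_le {α : Type*} [MeasurableSpace α] {μ : Measure α}
    [IsProbabilityMeasure μ] (hh : Measurable h) (hp : 1 ≤ p) :
    eLpNorm (fun _ : α => meanKernel Q h) p μ ≤ eLpNorm h p (Measure.pi fun _ => Q) := by
  rw [eLpNorm_const _ (zero_lt_one.trans_le hp).ne' (IsProbabilityMeasure.ne_zero μ), measure_univ,
    ENNReal.one_rpow, mul_one]
  exact enorm_integral_le_eLpNorm hh.aestronglyMeasurable hp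

lemma eLpNorm_projKernel_le (hh : Measurable h) (hp : 1 ≤ p) (l : Fin (d + 1)) :
    eLpNorm (projKernel Q h l) p Q ≤ 2 * eLpNorm h p (Measure.pi fun _ => Q) :=
  calc eLpNorm (projKernel Q h l) p Q
      ≤ eLpNorm (condKernel Q h l) p Q + eLpNorm (fun _ : S => meanKernel Q h) p Q :=
        eLpNorm_sub_le (measurable_condKernel hh l).aestronglyMeasurable
          aestronglyMeasurable_const hp
    _ ≤ eLpNorm h p (Measure.pi fun _ => Q) + eLpNorm h p (Measure.pi fun _ => Q) :=
        add_le_add (eLpNorm_condKernel_le hh hp l) (eLpNorm_const_meanKernel_le hh hp)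
    _ = 2 * eLpNorm h p (Measure.pi fun _ => Q) := (two_mul _).symm

lemma eLpNorm_projKernel_comp_eval_le (hh : Measurable h) (hp : 1 ≤ p) (l : Fin (d + 1)) :
    eLpNorm (fun z : Fin (d + 1) → S => projKernel Q h l (z l)) p (Measure.pi fun _ => Q) ≤
      2 * eLpNorm h p (Measure.pi fun _ => Q) :=
  (eLpNorm_comp_measurePreserving (g := projKernel Q h l)
    (measurable_projKernel hh l).aestronglyMeasurable
    (measurePreserving_eval (fun _ : Fin (d + 1) => Q) l)).trans_le (eLpNorm_projKernel_le hh hp l)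

lemma eLpNorm_degKernel_le (hh : Measurable h) (hp : 1 ≤ p) :
    eLpNorm (degKernel Q h) p (Measure.pi fun _ => Q) ≤
      (2 * d + 4) * eLpNorm h p (Measure.pi fun _ => Q) := by
  set N := eLpNorm h p (Measure.pi fun _ => Q)
  have hproj : ∀ l : Fin (d + 1), AEStronglyMeasurable
      (fun z : Fin (d + 1) → S => projKernel Q h l (z l)) (Measure.pi fun _ => Q) :=
    fun l => ((measurable_projKernel hh l).comp (measurable_pi_apply l)).aestronglyMeasurable
  have hcenter : eLpNorm (h - fun _ => meanKernel Q h) p (Measure.pi fun _ => Q) ≤ N + N :=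
    (eLpNorm_sub_le hh.aestronglyMeasurable aestronglyMeasurable_const hp).trans
      (add_le_add le_rfl (eLpNorm_const_meanKernel_le hh hp))
  have hsum : eLpNorm (∑ l, fun z : Fin (d + 1) → S => projKernel Q h l (z l)) p
      (Measure.pi fun _ => Q) ≤ ∑ _l : Fin (d + 1), 2 * N :=
    (eLpNorm_sum_le (fun l _ => hproj l) hp).trans
      (Finset.sum_le_sum fun l _ => eLpNorm_projKernel_comp_eval_le hh hp l)
  have hsplit : degKernel Q h =
      (h - fun _ => meanKernel Q h) - ∑ l, fun z : Fin (d + 1) → S => projKernel Q h l (z l) := by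
    ext z
    simp [degKernel]
  calc eLpNorm (degKernel Q h) p (Measure.pi fun _ => Q)
      ≤ N + N + ∑ _l : Fin (d + 1), 2 * N := hsplit ▸ (eLpNorm_sub_le
        (hh.sub_const _).aestronglyMeasurable
        (Finset.aestronglyMeasurable_sum _ fun l _ => hproj l) hp).trans (add_le_add hcenter hsum)
    _ = (2 * d + 4) * N := by
        simp only [Finset.sum_const, Finset.card_univ, Fintype.card_fin, nsmul_eq_mul]
        push_cast
        ring

lemma memLp_condKernel (hh : Measurable h) (hp : 1 ≤ p) (hhp : MemLp h p (Measure.pi fun _ => Q))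
    (l : Fin (d + 1)) : MemLp (condKernel Q h l) p Q :=
  ⟨(measurable_condKernel hh l).aestronglyMeasurable,
    (eLpNorm_condKernel_le hh hp l).trans_lt hhp.eLpNorm_lt_top⟩

lemma memLp_projKernel (hh : Measurable h) (hp : 1 ≤ p) (hhp : MemLp h p (Measure.pi fun _ => Q))
    (l : Fin (d + 1)) : MemLp (projKernel Q h l) p Q :=
  (memLp_condKernel hh hp hhp l).sub (memLp_const _)

lemma integrable_projKernel (hh : Measurable h) (hi : Integrable h (Measure.pi fun _ => Q))
    (l : Fin (d + 1)) : Integrable (projKernel Q h l) Q :=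
  memLp_one_iff_integrable.1 (memLp_projKernel hh le_rfl (memLp_one_iff_integrable.2 hi) l)

lemma memLp_degKernel (hh : Measurable h) (hp : 1 ≤ p) (hhp : MemLp h p (Measure.pi fun _ => Q)) :
    MemLp (degKernel Q h) p (Measure.pi fun _ => Q) :=
  ⟨(measurable_degKernel hh).aestronglyMeasurable, (eLpNorm_degKernel_le hh hp).trans_lt
    (ENNReal.mul_lt_top (by finiteness) hhp.eLpNorm_lt_top)⟩

lemma integral_condKernel_pow_le {k : ℕ} (hh : Measurable h)
    (hhp : MemLp h k (Measure.pi fun _ => Q)) (hk : Even k) (hk0 : k ≠ 0)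
    (l : Fin (d + 1)) :
    ∫ x, condKernel Q h l x ^ k ∂Q ≤ ∫ z, h z ^ k ∂(Measure.pi fun _ => Q) := by
  simpa using integral_pow_le_of_eLpNorm_le (C := 1)
    (measurable_condKernel hh l).aestronglyMeasurable hhp
    (by simpa using eLpNorm_condKernel_le hh (by exact_mod_cast Nat.one_le_iff_ne_zero.2 hk0) l)
    hk hk0

lemma integral_projKernel_pow_le {k : ℕ} (hh : Measurable h)
    (hhp : MemLp h k (Measure.pi fun _ => Q)) (hk : Even k) (hk0 : k ≠ 0)
    (l : Fin (d + 1)) :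
    ∫ x, projKernel Q h l x ^ k ∂Q ≤ 2 ^ k * ∫ z, h z ^ k ∂(Measure.pi fun _ => Q) := by
  simpa using integral_pow_le_of_eLpNorm_le (C := 2)
    (measurable_projKernel hh l).aestronglyMeasurable hhp
    (by simpa using eLpNorm_projKernel_le hh (by exact_mod_cast Nat.one_le_iff_ne_zero.2 hk0) l)
    hk hk0

lemma integral_degKernel_pow_le {k : ℕ} (hh : Measurable h)
    (hhp : MemLp h k (Measure.pi fun _ => Q)) (hk : Even k) (hk0 : k ≠ 0) :
    ∫ z, degKernel Q h z ^ k ∂(Measure.pi fun _ => Q) ≤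
      (2 * d + 4) ^ k * ∫ z, h z ^ k ∂(Measure.pi fun _ => Q) := by
  simpa using integral_pow_le_of_eLpNorm_le (C := 2 * d + 4)
    (measurable_degKernel hh).aestronglyMeasurable hhp
    (by simpa using eLpNorm_degKernel_le hh (by exact_mod_cast Nat.one_le_iff_ne_zero.2 hk0))
    hk hk0

lemma integrable_comp_insertNth {f : (Fin (d + 1) → S) → ℝ}
    (hf : Integrable f (Measure.pi fun _ => Q)) (l : Fin (d + 1)) :
    Integrable (fun p : S × (Fin d → S) => f (Fin.insertNth (α := fun _ => S) l p.1 p.2))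
      (Q.prod (Measure.pi fun _ => Q)) :=
  (measurePreserving_insertNth l).integrable_comp_of_integrable hf

lemma integral_condKernel (hi : Integrable h (Measure.pi fun _ => Q)) (l : Fin (d + 1)) :
    ∫ x, condKernel Q h l x ∂Q = meanKernel Q h :=
  (integral_prod _ (integrable_comp_insertNth hi l)).symm.trans
    (integral_comp_of_measurePreserving (measurePreserving_insertNth l) hi.1)

lemma integral_projKernel (hh : Measurable h) (hi : Integrable h (Measure.pi fun _ => Q))
    (l : Fin (d + 1)) : ∫ x, projKernel Q h l x ∂Q = 0 := by
  have hc : Integrable (condKernel Q h l) Q :=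
    memLp_one_iff_integrable.1 (memLp_condKernel hh le_rfl (memLp_one_iff_integrable.2 hi) l)
  simp [projKernel, integral_sub hc (integrable_const _), integral_condKernel hi l]

lemma ae_integral_degKernel_insertNth (hh : Measurable h)
    (hi : Integrable h (Measure.pi fun _ => Q)) (l : Fin (d + 1)) :
    ∀ᵐ x ∂Q, ∫ y, degKernel Q h (Fin.insertNth (α := fun _ => S) l x y)
      ∂(Measure.pi fun _ : Fin d => Q) = 0 := by
  filter_upwards [(integrable_comp_insertNth hi l).prod_right_ae] with x hx
  have hproj : ∀ k : Fin d, Integrable (fun y : Fin d → S => projKernel Q h (l.succAbove k) (y k))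
      (Measure.pi fun _ => Q) := fun k => integrable_comp_eval (integrable_projKernel hh hi _)
  have hproj0 : ∀ k : Fin d, ∫ y : Fin d → S, projKernel Q h (l.succAbove k) (y k)
      ∂(Measure.pi fun _ => Q) = 0 := fun k => by
    rw [integral_comp_eval (measurable_projKernel hh _).aestronglyMeasurable,
      integral_projKernel hh hi]
  have hcenter : Integrable (fun y => h (Fin.insertNth (α := fun _ => S) l x y) -
      condKernel Q h l x) (Measure.pi fun _ => Q) := hx.sub (integrable_const _)
  simp only [degKernel_insertNth]
  rw [integral_sub hcenter (integrable_finsetSum _ fun k _ => hproj k),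
    integral_sub hx (integrable_const _), integral_finsetSum _ fun k _ => hproj k]
  simp [hproj0, condKernel]

end Kernel

section Integral

variable {Ω : Type*} [MeasurableSpace Ω] {μ : Measure Ω}

lemma two_mul_abs_integral_mul_le {f g : Ω → ℝ} (hf : MemLp f 2 μ) (hg : MemLp g 2 μ) :
    2 * |∫ ω, f ω * g ω ∂μ| ≤ ∫ ω, f ω ^ 2 ∂μ + ∫ ω, g ω ^ 2 ∂μ := by
  have hfg := hf.integrable_mul hg
  calc 2 * |∫ ω, f ω * g ω ∂μ| ≤ 2 * ∫ ω, |f ω * g ω| ∂μ := by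
        gcongr
        exact abs_integral_le_integral_abs
    _ = ∫ ω, 2 * |f ω * g ω| ∂μ := (integral_const_mul _ _).symm
    _ ≤ ∫ ω, (f ω ^ 2 + g ω ^ 2) ∂μ := by
        refine integral_mono (hfg.abs.const_mul 2) (hf.integrable_sq.add hg.integrable_sq)
          fun ω => ?_
        simpa only [abs_mul, sq_abs, mul_assoc] using two_mul_le_add_sq |f ω| |g ω|
    _ = ∫ ω, f ω ^ 2 ∂μ + ∫ ω, g ω ^ 2 ∂μ := integral_add hf.integrable_sq hg.integrable_sq

lemma integral_mul_eq_zero_of_indepFun [IsProbabilityMeasure μ] {α β : Type*} [MeasurableSpace α]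
    [MeasurableSpace β] {A : Ω → α} {B : Ω → β} (hA : Measurable A) (hB : Measurable B)
    (hAB : IndepFun A B μ) {F : α × β → ℝ} (hF : Measurable F) {G : α → ℝ} (hG : Measurable G)
    (h0 : ∀ᵐ x ∂(μ.map A), ∫ y, F (x, y) ∂(μ.map B) = 0) :
    ∫ ω, F (A ω, B ω) * G (A ω) ∂μ = 0 := by
  have := Measure.isProbabilityMeasure_map (μ := μ) hA.aemeasurable
  have := Measure.isProbabilityMeasure_map (μ := μ) hB.aemeasurable
  have hlaw : μ.map (fun ω => (A ω, B ω)) = (μ.map A).prod (μ.map B) :=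
    (indepFun_iff_map_prod_eq_prod_map_map hA.aemeasurable hB.aemeasurable).1 hAB
  have hFG : Measurable fun p : α × β => F p * G p.1 := hF.mul (hG.comp measurable_fst)
  calc ∫ ω, F (A ω, B ω) * G (A ω) ∂μ
      = ∫ p, F p * G p.1 ∂((μ.map A).prod (μ.map B)) := by
        rw [← hlaw, integral_map (hA.prodMk hB).aemeasurable hFG.aestronglyMeasurable]
    _ = 0 := by
        by_cases hi : Integrable (fun p : α × β => F p * G p.1) ((μ.map A).prod (μ.map B))
        · rw [integral_prod _ hi]
          refine integral_eq_zero_of_ae ?_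
          filter_upwards [h0] with x hx
          simp [integral_mul_const, hx]
        · exact integral_undef hi

end Integral

section Sample

variable {Ω S ι : Type*} [MeasurableSpace Ω] [MeasurableSpace S]

/-- The random variables `X i` are independent with common law `Q`. -/
structure IsSample (μ : Measure Ω) (X : ι → Ω → S) (Q : Measure S) : Prop where
  measurable : ∀ i, Measurable (X i)
  indep : iIndepFun X μ
  law : ∀ i, μ.map (X i) = Q

namespace IsSample

variable {μ : Measure Ω} {X : ι → Ω → S} {Q : Measure S}

lemma measurePreserving (hs : IsSample μ X Q) (i : ι) : MeasurePreserving (X i) μ Q :=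
  ⟨hs.measurable i, hs.law i⟩

lemma measurable_tuple (hs : IsSample μ X Q) {κ : Type*} (I : κ → ι) :
    Measurable fun ω k => X (I k) ω :=
  measurable_pi_lambda _ fun k => hs.measurable (I k)

lemma measurePreserving_tuple [IsProbabilityMeasure μ] (hs : IsSample μ X Q) {κ : Type*}
    [Fintype κ] {I : κ → ι} (hI : Function.Injective I) :
    MeasurePreserving (fun ω k => X (I k) ω) μ (Measure.pi fun _ => Q) := by
  refine ⟨hs.measurable_tuple I, ?_⟩
  rw [(iIndepFun_iff_map_fun_eq_pi_map fun k => (hs.measurable (I k)).aemeasurable).1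
    (hs.indep.precomp hI)]
  simp only [hs.law]

lemma indepFun_tuple [Finite ι] (hs : IsSample μ X Q) {κ κ' : Type*} {I : κ → ι} {J : κ' → ι}
    (hIJ : ∀ k j, I k ≠ J j) :
    IndepFun (fun ω k => X (I k) ω) (fun ω j => X (J j) ω) μ := by
  let rI := (Set.toFinite (Set.range I)).toFinset
  let rJ := (Set.toFinite (Set.range J)).toFinset
  have hdisj : Disjoint rI rJ := by
    simp only [rI, rJ, Set.Finite.disjoint_toFinset, Set.disjoint_left, Set.mem_range]
    rintro i ⟨k, rfl⟩ ⟨j, hj⟩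
    exact hIJ k j hj.symm
  have hI : Measurable fun (z : rI → S) k => z ⟨I k, by simp [rI]⟩ := by fun_prop
  have hJ : Measurable fun (z : rJ → S) j => z ⟨J j, by simp [rJ]⟩ := by fun_prop
  exact (hs.indep.indepFun_finset rI rJ hdisj hs.measurable).comp hI hJ

lemma integral_mul_eq_zero_of_ae_integral_eq_zero [Finite ι] [IsProbabilityMeasure μ]
    (hs : IsSample μ X Q) {κ κ' : Type*} [Fintype κ] {F : S × (κ → S) → ℝ} (hF : Measurable F)
    (hF0 : ∀ᵐ x ∂Q, ∫ y, F (x, y) ∂(Measure.pi fun _ => Q) = 0)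
    {v : ι} {I : κ → ι} (hI : Function.Injective I) (hv : ∀ k, v ≠ I k)
    {J : κ' → ι} (hJ : ∀ j k, J j ≠ I k) {G : (κ' → S) → ℝ} (hG : Measurable G) :
    ∫ ω, F (X v ω, fun k => X (I k) ω) * G (fun j => X (J j) ω) ∂μ = 0 := by
  let vJ : Option κ' → ι := fun o => o.elim v J
  have hvJ : ∀ o k, vJ o ≠ I k := by
    rintro (_ | j) k
    exacts [hv k, hJ j k]
  refine integral_mul_eq_zero_of_indepFun (F := fun p => F (p.1 none, p.2))
    (G := fun z => G fun j => z (some j)) (hs.measurable_tuple vJ) (hs.measurable_tuple I)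
    (hs.indepFun_tuple hvJ) (by fun_prop) (by fun_prop) ?_
  have heval : MeasurePreserving (fun z : Option κ' → S => z none)
      (μ.map fun ω o => X (vJ o) ω) Q := by
    refine ⟨measurable_pi_apply none, ?_⟩
    rw [Measure.map_map (measurable_pi_apply none) (hs.measurable_tuple vJ)]
    exact hs.law v
  rw [(hs.measurePreserving_tuple hI).map_eq]
  exact heval.quasiMeasurePreserving.ae hF0

lemma integral_sum_comp_sq [Fintype ι] [IsProbabilityMeasure μ] (hs : IsSample μ X Q)
    {f : ι → S → ℝ} (hf : ∀ i, Measurable (f i)) (hf2 : ∀ i, MemLp (f i) 2 Q)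
    (hf0 : ∀ i, ∫ x, f i x ∂Q = 0) :
    ∫ ω, (∑ i, f i (X i ω)) ^ 2 ∂μ = ∑ i, ∫ x, f i x ^ 2 ∂Q := by
  have hL : ∀ i, MemLp (fun ω => f i (X i ω)) 2 μ := fun i =>
    (hf2 i).comp_measurePreserving (hs.measurePreserving i)
  have hL0 : ∀ i, ∫ ω, f i (X i ω) ∂μ = 0 := fun i =>
    (integral_comp_of_measurePreserving (hs.measurePreserving i) (hf2 i).1).trans (hf0 i)
  have hsum0 : ∫ ω, (∑ i, fun ω => f i (X i ω)) ω ∂μ = 0 := by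
    simp only [Finset.sum_apply]
    rw [integral_finsetSum _ fun i _ => (hL i).integrable one_le_two]
    exact Finset.sum_eq_zero fun i _ => hL0 i
  calc ∫ ω, (∑ i, f i (X i ω)) ^ 2 ∂μ = variance (∑ i, fun ω => f i (X i ω)) μ := by
        rw [variance_of_integral_eq_zero (memLp_finsetSum' _ fun i _ => hL i).1.aemeasurable hsum0]
        simp only [Finset.sum_apply]
    _ = ∑ i, variance (fun ω => f i (X i ω)) μ := IndepFun.variance_sum (fun i _ => hL i)
        fun i _ j _ hij => (hs.indep.indepFun hij).comp (hf i) (hf j)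
    _ = ∑ i, ∫ x, f i x ^ 2 ∂Q := Finset.sum_congr rfl fun i _ => by
        rw [variance_of_integral_eq_zero (hL i).1.aemeasurable (hL0 i)]
        exact integral_comp_of_measurePreserving (f := fun x => f i x ^ 2)
          (hs.measurePreserving i) ((hf2 i).1.pow 2)

end IsSample

end Sample

section Decomposition

variable {Ω S : Type*} [MeasurableSpace S] {d n : ℕ}

/-- The first order expansion `h1` of `U`, written in terms of the common law `Q`. -/
noncomputable def projSum (Q : Measure S) (a : (Fin (d + 1) → Fin n) → ℝ)
    (h : (Fin (d + 1) → S) → ℝ) (i : Fin n) (x : S) : ℝ :=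
  ∑ l, weightCoef a l i * projKernel Q h l x

/-- The linear (first order) part of the Hoeffding decomposition of `U`. -/
noncomputable def linearPart (Q : Measure S) (a : (Fin (d + 1) → Fin n) → ℝ)
    (h : (Fin (d + 1) → S) → ℝ) (X : Fin n → Ω → S) (ω : Ω) : ℝ :=
  (n : ℝ)⁻¹ * ∑ i, projSum Q a h i (X i ω)

/-- The sum of the parts of order at least two of the Hoeffding decomposition of `U`. -/
noncomputable def remainder (Q : Measure S) (a : (Fin (d + 1) → Fin n) → ℝ)
    (h : (Fin (d + 1) → S) → ℝ) (X : Fin n → Ω → S) (ω : Ω) : ℝ :=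
  normFactor (d + 1) n * ∑ I ∈ indexSet (d + 1) n, a I * degKernel Q h (fun k => X (I k) ω)

lemma U_eq_add_linearPart_add_remainder (Q : Measure S) (a : (Fin (d + 1) → Fin n) → ℝ)
    (h : (Fin (d + 1) → S) → ℝ) (X : Fin n → Ω → S) (ω : Ω) :
    U a h X ω = normFactor (d + 1) n * (∑ I ∈ indexSet (d + 1) n, a I) * meanKernel Q h +
      (linearPart Q a h X ω + remainder Q a h X ω) := by
  have hlin : linearPart Q a h X ω = normFactor (d + 1) n *
      ∑ I ∈ indexSet (d + 1) n, a I * ∑ l, projKernel Q h l (X (I l) ω) :=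
    (normFactor_mul_sum_weighted_sum_eq a fun l i => projKernel Q h l (X i ω)).symm
  rw [hlin, remainder, ← mul_add, ← Finset.sum_add_distrib, mul_assoc, Finset.sum_mul, ← mul_add,
    ← Finset.sum_add_distrib]
  refine congrArg (normFactor (d + 1) n * ·) (Finset.sum_congr rfl fun I _ => ?_)
  simp only [degKernel]
  ring

variable [MeasurableSpace Ω] {μ : Measure Ω} {X : Fin n → Ω → S} {Q : Measure S}
  {h : (Fin (d + 1) → S) → ℝ} {p : ℝ≥0∞}

section ProbabilityMeasure

variable [IsProbabilityMeasure Q]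

lemma measurable_projSum (hh : Measurable h) (a : (Fin (d + 1) → Fin n) → ℝ) (i : Fin n) :
    Measurable (projSum Q a h i) :=
  Finset.measurable_fun_sum _ fun l _ => (measurable_projKernel hh l).const_mul _

lemma memLp_projSum (hh : Measurable h) (hp : 1 ≤ p) (hhp : MemLp h p (Measure.pi fun _ => Q))
    (a : (Fin (d + 1) → Fin n) → ℝ) (i : Fin n) : MemLp (projSum Q a h i) p Q :=
  memLp_finsetSum _ fun l _ => (memLp_projKernel hh hp hhp l).const_mul _

lemma integral_projSum (hh : Measurable h) (hi : Integrable h (Measure.pi fun _ => Q))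
    (a : (Fin (d + 1) → Fin n) → ℝ) (i : Fin n) : ∫ x, projSum Q a h i x ∂Q = 0 := by
  unfold projSum
  rw [integral_finsetSum _ fun l _ => (integrable_projKernel hh hi l).const_mul _]
  simp [integral_const_mul, integral_projKernel hh hi]

end ProbabilityMeasure

namespace IsSample

lemma h1_eq [IsProbabilityMeasure μ] (hs : IsSample μ X Q) (hh : Measurable h)
    (a : (Fin (d + 1) → Fin n) → ℝ) (i : Fin n) : h1 μ a h X i = projSum Q a h i := by
  ext x
  simp only [h1, h1At, projSum, weightCoef, projKernel]
  rw [Finset.sum_comm, Finset.mul_sum]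
  refine Finset.sum_congr rfl fun l _ => ?_
  rw [mul_assoc, Finset.sum_mul]
  refine congrArg (_ * ·) (Finset.sum_congr rfl fun J hJ => ?_)
  have hproj : proj μ h X l J x = condKernel Q h l x := by simp only [proj, condKernel, hs.law]
  have htheta : theta μ h X (Fin.insertNth (α := fun _ => Fin n) l i J) = meanKernel Q h :=
    integral_comp_of_measurePreserving (hs.measurePreserving_tuple
      (insertNth_injective_iff.2 (mem_indexSetAvoiding.1 hJ))) hh.aestronglyMeasurable
  rw [hproj, htheta]

lemma V_eq_variance_linearPart [IsProbabilityMeasure μ] (hs : IsSample μ X Q)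
    (hh : Measurable h) (a : (Fin (d + 1) → Fin n) → ℝ) :
    V μ a h X = variance (linearPart Q a h X) μ := by
  simp only [V, hs.h1_eq hh a]
  rfl

variable [IsProbabilityMeasure Q]

lemma memLp_projSum_comp (hs : IsSample μ X Q) (hh : Measurable h) (hp : 1 ≤ p)
    (hhp : MemLp h p (Measure.pi fun _ => Q)) (a : (Fin (d + 1) → Fin n) → ℝ) (i j : Fin n) :
    MemLp (fun ω => projSum Q a h i (X j ω)) p μ :=
  (memLp_projSum hh hp hhp a i).comp_measurePreserving (hs.measurePreserving j)

lemma integral_projSum_comp (hs : IsSample μ X Q) (hh : Measurable h)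
    (hi : Integrable h (Measure.pi fun _ => Q)) (a : (Fin (d + 1) → Fin n) → ℝ) (i j : Fin n) :
    ∫ ω, projSum Q a h i (X j ω) ∂μ = 0 := by
  rw [integral_comp_of_measurePreserving (hs.measurePreserving j)
    (measurable_projSum hh a i).aestronglyMeasurable, integral_projSum hh hi]

lemma memLp_linearPart (hs : IsSample μ X Q) (hh : Measurable h) (hp : 1 ≤ p)
    (hhp : MemLp h p (Measure.pi fun _ => Q)) (a : (Fin (d + 1) → Fin n) → ℝ) :
    MemLp (linearPart Q a h X) p μ :=
  (memLp_finsetSum _ fun i _ => hs.memLp_projSum_comp hh hp hhp a i i).const_mul _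

lemma integral_linearPart (hs : IsSample μ X Q) (hh : Measurable h)
    (hi : Integrable h (Measure.pi fun _ => Q)) (a : (Fin (d + 1) → Fin n) → ℝ) :
    ∫ ω, linearPart Q a h X ω ∂μ = 0 := by
  unfold linearPart
  rw [integral_const_mul, integral_finsetSum _ fun i _ => memLp_one_iff_integrable.1 <|
    hs.memLp_projSum_comp hh le_rfl (memLp_one_iff_integrable.2 hi) a i i]
  simp [hs.integral_projSum_comp hh hi]

variable [IsProbabilityMeasure μ]

lemma integral_degKernel_mul_eq_zero (hs : IsSample μ X Q) (hh : Measurable h)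
    (hi : Integrable h (Measure.pi fun _ => Q)) {I : Fin (d + 1) → Fin n}
    (hI : Function.Injective I) {κ : Type*} {J : κ → Fin n}
    (hIJ : (Set.range I ∩ Set.range J).Subsingleton) {G : (κ → S) → ℝ} (hG : Measurable G) :
    ∫ ω, degKernel Q h (fun k => X (I k) ω) * G (fun j => X (J j) ω) ∂μ = 0 := by
  obtain ⟨l, hl⟩ : ∃ l : Fin (d + 1), ∀ j k, J j = I k → k = l := by
    by_cases hex : ∃ l, I l ∈ Set.range J
    · obtain ⟨l, hl⟩ := hex
      exact ⟨l, fun j k hk => hI (hIJ ⟨⟨k, rfl⟩, j, hk⟩ ⟨⟨l, rfl⟩, hl⟩)⟩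
    · exact ⟨0, fun j k hk => absurd ⟨k, j, hk⟩ hex⟩
  have horth := hs.integral_mul_eq_zero_of_ae_integral_eq_zero
    (F := fun p => degKernel Q h (Fin.insertNth (α := fun _ => S) l p.1 p.2))
    ((measurable_degKernel hh).comp (measurable_insertNth l))
    (ae_integral_degKernel_insertNth hh hi l) (v := I l)
    (hI.comp Fin.succAbove_right_injective) (fun k hk => Fin.succAbove_ne l k (hI hk).symm)
    (fun j k hk => Fin.succAbove_ne l k (hl j _ hk)) hG
  rw [← horth]
  refine integral_congr_ae (ae_of_all _ fun ω => ?_)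
  exact congrArg (degKernel Q h · * _) (Fin.insertNth_self_removeNth l fun k => X (I k) ω).symm

lemma memLp_degKernel_comp (hs : IsSample μ X Q) (hh : Measurable h) (hp : 1 ≤ p)
    (hhp : MemLp h p (Measure.pi fun _ => Q)) {I : Fin (d + 1) → Fin n}
    (hI : Function.Injective I) : MemLp (fun ω => degKernel Q h (fun k => X (I k) ω)) p μ :=
  (memLp_degKernel hh hp hhp).comp_measurePreserving (hs.measurePreserving_tuple hI)

lemma memLp_remainder (hs : IsSample μ X Q) (hh : Measurable h) (hp : 1 ≤ p)
    (hhp : MemLp h p (Measure.pi fun _ => Q)) (a : (Fin (d + 1) → Fin n) → ℝ) :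
    MemLp (remainder Q a h X) p μ :=
  (memLp_finsetSum _ fun _ hI =>
    (hs.memLp_degKernel_comp hh hp hhp (mem_indexSet.1 hI)).const_mul _).const_mul _

lemma V_eq (hs : IsSample μ X Q) (hh : Measurable h) (hh2 : MemLp h 2 (Measure.pi fun _ => Q))
    (a : (Fin (d + 1) → Fin n) → ℝ) :
    V μ a h X = ((n : ℝ) ^ 2)⁻¹ * ∑ i, ∫ x, projSum Q a h i x ^ 2 ∂Q := by
  have hi := hh2.integrable one_le_two
  rw [hs.V_eq_variance_linearPart hh, variance_of_integral_eq_zero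
    (hs.memLp_linearPart hh one_le_two hh2 a).1.aemeasurable (hs.integral_linearPart hh hi a),
    ← hs.integral_sum_comp_sq (measurable_projSum hh a) (memLp_projSum hh one_le_two hh2 a)
      (integral_projSum hh hi a), ← integral_const_mul]
  simp only [linearPart, mul_pow, inv_pow]

lemma integral_linearPart_mul_remainder (hs : IsSample μ X Q) (hh : Measurable h)
    (hh2 : MemLp h 2 (Measure.pi fun _ => Q)) (a : (Fin (d + 1) → Fin n) → ℝ) :
    ∫ ω, linearPart Q a h X ω * remainder Q a h X ω ∂μ = 0 := by
  have hexpand : ∀ ω, linearPart Q a h X ω * remainder Q a h X ω =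
      (n : ℝ)⁻¹ * normFactor (d + 1) n * ∑ i, ∑ I ∈ indexSet (d + 1) n, a I *
        (degKernel Q h (fun k => X (I k) ω) * projSum Q a h i (X i ω)) := fun ω => by
    rw [linearPart, remainder, mul_mul_mul_comm, Finset.sum_mul_sum]
    refine congrArg (_ * ·) (Finset.sum_congr rfl fun i _ => Finset.sum_congr rfl fun I _ => ?_)
    ring
  have hint : ∀ i, ∀ I ∈ indexSet (d + 1) n, Integrable (fun ω => a I *
      (degKernel Q h (fun k => X (I k) ω) * projSum Q a h i (X i ω))) μ := fun i I hI =>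
    ((hs.memLp_degKernel_comp hh one_le_two hh2 (mem_indexSet.1 hI)).integrable_mul
      (hs.memLp_projSum_comp hh one_le_two hh2 a i i)).const_mul _
  have horth : ∀ i, ∀ I ∈ indexSet (d + 1) n,
      ∫ ω, degKernel Q h (fun k => X (I k) ω) * projSum Q a h i (X i ω) ∂μ = 0 := fun i I hI =>
    hs.integral_degKernel_mul_eq_zero hh (hh2.integrable one_le_two) (mem_indexSet.1 hI)
      (J := fun _ : Unit => i) (by
        simpa using Set.subsingleton_singleton.anti Set.inter_subset_right)
      (G := fun z => projSum Q a h i (z ()))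
      ((measurable_projSum hh a i).comp (measurable_pi_apply _))
  simp only [hexpand]
  rw [integral_const_mul, integral_finsetSum _ fun i _ => integrable_finsetSum _ (hint i)]
  refine mul_eq_zero_of_right _ (Finset.sum_eq_zero fun i _ => ?_)
  rw [integral_finsetSum _ (hint i)]
  exact Finset.sum_eq_zero fun I hI => by rw [integral_const_mul, horth i I hI, mul_zero]

lemma abs_integral_degKernel_mul_degKernel_le (hs : IsSample μ X Q) (hh : Measurable h)
    (hh2 : MemLp h 2 (Measure.pi fun _ => Q)) {I J : Fin (d + 1) → Fin n}
    (hI : Function.Injective I) (hJ : Function.Injective J) :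
    |∫ ω, degKernel Q h (fun k => X (I k) ω) * degKernel Q h (fun k => X (J k) ω) ∂μ| ≤
      (2 * d + 4) ^ 2 * ∫ z, h z ^ 2 ∂(Measure.pi fun _ => Q) := by
  have hsq {I : Fin (d + 1) → Fin n} (hI : Function.Injective I) :
      ∫ ω, degKernel Q h (fun k => X (I k) ω) ^ 2 ∂μ ≤
        (2 * d + 4) ^ 2 * ∫ z, h z ^ 2 ∂(Measure.pi fun _ => Q) :=
    (integral_comp_of_measurePreserving (f := fun z => degKernel Q h z ^ 2)
      (hs.measurePreserving_tuple hI)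
      ((measurable_degKernel hh).pow_const 2).aestronglyMeasurable).trans_le
      (integral_degKernel_pow_le hh (by exact_mod_cast hh2) even_two two_ne_zero)
  linarith [hsq hI, hsq hJ, two_mul_abs_integral_mul_le
    (hs.memLp_degKernel_comp hh one_le_two hh2 hI) (hs.memLp_degKernel_comp hh one_le_two hh2 hJ)]

lemma integral_remainder_sq_eq (hs : IsSample μ X Q) (hh : Measurable h)
    (hh2 : MemLp h 2 (Measure.pi fun _ => Q)) (a : (Fin (d + 1) → Fin n) → ℝ) :
    ∫ ω, remainder Q a h X ω ^ 2 ∂μ =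
      normFactor (d + 1) n ^ 2 * ∑ T ∈ sharingAtLeast 2 2 (d + 1) n, (∏ k, a (T k)) *
        ∫ ω, degKernel Q h (fun k => X (T 0 k) ω) * degKernel Q h (fun k => X (T 1 k) ω) ∂μ := by
  classical
  set pairs := Fintype.piFinset fun _ : Fin 2 => indexSet (d + 1) n
  have hmem : ∀ T ∈ pairs, ∀ k, T k ∈ indexSet (d + 1) n := fun T => Fintype.mem_piFinset.1
  have hexpand : ∀ ω, remainder Q a h X ω ^ 2 = normFactor (d + 1) n ^ 2 * ∑ T ∈ pairs,
      (∏ k, a (T k)) *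
        (degKernel Q h (fun k => X (T 0 k) ω) * degKernel Q h (fun k => X (T 1 k) ω)) := fun ω => by
    rw [remainder, mul_pow, Finset.sum_pow']
    refine congrArg (_ * ·) (Finset.sum_congr rfl fun T _ => ?_)
    rw [Finset.prod_mul_distrib, Fin.prod_univ_two fun k => degKernel Q h fun j => X (T k j) ω]
  have hint : ∀ T ∈ pairs, Integrable (fun ω => (∏ k, a (T k)) *
      (degKernel Q h (fun k => X (T 0 k) ω) * degKernel Q h (fun k => X (T 1 k) ω))) μ :=
    fun T hT => ((hs.memLp_degKernel_comp hh one_le_two hh2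
      (mem_indexSet.1 (hmem T hT 0))).integrable_mul
      (hs.memLp_degKernel_comp hh one_le_two hh2 (mem_indexSet.1 (hmem T hT 1)))).const_mul _
  simp only [hexpand]
  rw [integral_const_mul, integral_finsetSum _ hint]
  simp only [integral_const_mul]
  refine congrArg (_ * ·) (Finset.sum_subset
    (fun T hT => Fintype.mem_piFinset.2 (mem_sharingAtLeast.1 hT).1) fun T hT hT2 => ?_).symm
  have hcard : (commonIndices T).card ≤ 1 := by
    by_contra! hc
    exact hT2 (mem_sharingAtLeast.2 ⟨hmem T hT, hc⟩)
  have hcommon : Set.range (T 0) ∩ Set.range (T 1) = commonIndices T := by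
    ext v
    simp [mem_commonIndices, Fin.forall_fin_two]
  refine mul_eq_zero_of_right _ (hs.integral_degKernel_mul_eq_zero hh (hh2.integrable one_le_two)
    (mem_indexSet.1 (hmem T hT 0)) ?_ (measurable_degKernel hh))
  rw [hcommon]
  exact Finset.card_le_one_iff_subsingleton.1 hcard

lemma integral_remainder_sq_le (hs : IsSample μ X Q) (hh : Measurable h)
    (hh2 : MemLp h 2 (Measure.pi fun _ => Q)) (a : (Fin (d + 1) → Fin n) → ℝ) :
    ∫ ω, remainder Q a h X ω ^ 2 ∂μ ≤
      sharedWeight 2 2 a * ((2 * d + 4) ^ 2 * ∫ z, h z ^ 2 ∂(Measure.pi fun _ => Q)) := by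
  rw [hs.integral_remainder_sq_eq hh hh2, sharedWeight, mul_assoc, Finset.sum_mul]
  refine mul_le_mul_of_nonneg_left (Finset.sum_le_sum fun T hT => ?_) (sq_nonneg _)
  have hT' := (mem_sharingAtLeast.1 hT).1
  refine (le_abs_self _).trans ?_
  rw [abs_mul]
  gcongr
  exact hs.abs_integral_degKernel_mul_degKernel_le hh hh2 (mem_indexSet.1 (hT' 0))
    (mem_indexSet.1 (hT' 1))

lemma variance_U (hs : IsSample μ X Q) (hh : Measurable h)
    (hh2 : MemLp h 2 (Measure.pi fun _ => Q)) (a : (Fin (d + 1) → Fin n) → ℝ) :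
    variance (U a h X) μ = V μ a h X + variance (remainder Q a h X) μ := by
  have hL := hs.memLp_linearPart hh one_le_two hh2 a
  have hR := hs.memLp_remainder hh one_le_two hh2 a
  have hcov : covariance (linearPart Q a h X) (remainder Q a h X) μ = 0 := by
    simp [covariance_eq_sub hL hR, hs.integral_linearPart_mul_remainder hh hh2,
      hs.integral_linearPart hh (hh2.integrable one_le_two)]
  have hU : U a h X = fun ω => normFactor (d + 1) n * (∑ I ∈ indexSet (d + 1) n, a I) *
      meanKernel Q h + (linearPart Q a h X + remainder Q a h X) ω :=
    funext (U_eq_add_linearPart_add_remainder Q a h X)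
  rw [hU, variance_const_add (hL.add hR).1, variance_add hL hR, hcov,
    hs.V_eq_variance_linearPart hh]
  ring

lemma V_le_variance_U (hs : IsSample μ X Q) (hh : Measurable h)
    (hh2 : MemLp h 2 (Measure.pi fun _ => Q)) (a : (Fin (d + 1) → Fin n) → ℝ) :
    V μ a h X ≤ variance (U a h X) μ := by
  linarith [hs.variance_U hh hh2 a, variance_nonneg (remainder Q a h X) μ]

lemma variance_U_le (hs : IsSample μ X Q) (hh : Measurable h)
    (hh2 : MemLp h 2 (Measure.pi fun _ => Q)) (a : (Fin (d + 1) → Fin n) → ℝ) :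
    variance (U a h X) μ ≤ V μ a h X +
      sharedWeight 2 2 a * ((2 * d + 4) ^ 2 * ∫ z, h z ^ 2 ∂(Measure.pi fun _ => Q)) := by
  have hle : variance (remainder Q a h X) μ ≤ ∫ ω, remainder Q a h X ω ^ 2 ∂μ :=
    variance_le_expectation_sq (hs.memLp_remainder hh one_le_two hh2 a).1
  linarith [hs.variance_U hh hh2 a, hs.integral_remainder_sq_le hh hh2 a]

end IsSample

end Decomposition

section Empirical

variable {S κ : Type*} [MeasurableSpace S] [Fintype κ] {n : ℕ}

lemma empirical_eq_map (x : Fin n → S) : empirical x = (empirical (id : Fin n → Fin n)).map x := by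
  have hx : Measurable x := measurable_of_countable x
  simp only [empirical, id, Measure.map_smul, Measure.map_finset_sum hx.aemeasurable,
    Measure.map_dirac' hx]

lemma real_empirical_id_singleton (i : Fin n) :
    (empirical (id : Fin n → Fin n)).real {i} = (n : ℝ)⁻¹ := by
  classical
  simp [empirical, Measure.real, Set.indicator_apply]

variable [NeZero n]

instance (x : Fin n → S) : IsProbabilityMeasure (empirical x) :=
  ⟨by simp [empirical, ENNReal.inv_mul_cancel, NeZero.ne n]⟩

lemma pi_empirical_eq_map (x : Fin n → S) :
    Measure.pi (fun _ : κ => empirical x) =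
      (Measure.pi fun _ : κ => empirical (id : Fin n → Fin n)).map fun J k => x (J k) := by
  have : IsProbabilityMeasure ((empirical (id : Fin n → Fin n)).map x) :=
    empirical_eq_map x ▸ inferInstance
  rw [empirical_eq_map]
  exact (Measure.pi_map_pi (f := fun _ => x)
    fun _ => (measurable_of_countable x).aemeasurable).symm

lemma integral_pi_empirical [DecidableEq κ] (x : Fin n → S) {g : (κ → S) → ℝ} (hg : Measurable g) :
    ∫ z, g z ∂(Measure.pi fun _ : κ => empirical x) =
      ((n : ℝ) ^ Fintype.card κ)⁻¹ * ∑ J : κ → Fin n, g fun k => x (J k) := by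
  rw [pi_empirical_eq_map, integral_map (measurable_of_countable _).aemeasurable
    hg.aestronglyMeasurable, integral_fintype Integrable.of_finite, Finset.mul_sum]
  refine Finset.sum_congr rfl fun J _ => ?_
  rw [Measure.real, Measure.pi_singleton, ENNReal.toReal_prod]
  simp [← Measure.real_def, real_empirical_id_singleton]

lemma integral_empirical (x : Fin n → S) {g : S → ℝ} (hg : Measurable g) :
    ∫ z, g z ∂(empirical x) = (n : ℝ)⁻¹ * ∑ i, g (x i) := by
  rw [empirical_eq_map, integral_map (measurable_of_countable _).aemeasurable
    hg.aestronglyMeasurable, integral_fintype Integrable.of_finite, Finset.mul_sum]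
  simp [real_empirical_id_singleton]

lemma memLp_pi_empirical (x : Fin n → S) {g : (κ → S) → ℝ} (hg : Measurable g) (p : ℝ≥0∞) :
    MemLp g p (Measure.pi fun _ : κ => empirical x) := by
  rw [pi_empirical_eq_map, memLp_map_measure_iff hg.aestronglyMeasurable
    (measurable_of_countable _).aemeasurable]
  exact MemLp.of_discrete

lemma isSample_bootstrapLaw (x : Fin n → S) :
    IsSample (bootstrapLaw x) (fun i y => y i) (empirical x) where
  measurable := measurable_pi_apply
  indep := iIndepFun_pi (X := fun _ : Fin n => (id : S → S)) fun _ => aemeasurable_id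
  law i := (measurePreserving_eval (fun _ : Fin n => empirical x) i).map_eq

end Empirical

section CondCentred

variable {S : Type*} [MeasurableSpace S] {d n : ℕ} {h : (Fin (d + 1) → S) → ℝ} {Q : Measure S}

/-- The kernel minus its conditional mean given the argument at position `l`. -/
noncomputable def condCentred (Q : Measure S) (h : (Fin (d + 1) → S) → ℝ) (l : Fin (d + 1))
    (p : S × (Fin d → S)) : ℝ :=
  h (Fin.insertNth (α := fun _ => S) l p.1 p.2) - condKernel Q h l p.1

lemma condCentred_comp {Ω : Type*} (X : Fin n → Ω → S) (l : Fin (d + 1)) (j : Fin n)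
    (J : Fin d → Fin n) (ω : Ω) :
    condCentred Q h l (X j ω, fun k => X (J k) ω) =
      h (fun k => X (Fin.insertNth (α := fun _ => Fin n) l j J k) ω) -
        condKernel Q h l (X j ω) := by
  have htuple : Fin.insertNth (α := fun _ => S) l (X j ω) (fun k => X (J k) ω) =
      fun k => X (Fin.insertNth (α := fun _ => Fin n) l j J k) ω :=
    Fin.insertNth_eq_iff.2 ⟨by simp, by ext; simp [Fin.removeNth]⟩
  rw [condCentred, htuple]

lemma condKernel_empirical_sub [NeZero n] (hh : Measurable h) (l : Fin (d + 1)) (x : Fin n → S)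
    (y : S) :
    condKernel (empirical x) h l y - condKernel Q h l y =
      ((n : ℝ) ^ d)⁻¹ * ∑ J : Fin d → Fin n, condCentred Q h l (y, fun k => x (J k)) := by
  have hmean := integral_pi_empirical x
    (hh.comp ((measurable_insertNth l).comp (measurable_prodMk_left (x := y))))
  simp only [Function.comp_def, Fintype.card_fin] at hmean
  simp [condKernel, condCentred, hmean, mul_sub, NeZero.ne n]

variable [IsProbabilityMeasure Q]

lemma measurable_condCentred (hh : Measurable h) (l : Fin (d + 1)) :
    Measurable (condCentred Q h l) :=
  (hh.comp (measurable_insertNth l)).sub ((measurable_condKernel hh l).comp measurable_fst)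

lemma ae_integral_condCentred (hi : Integrable h (Measure.pi fun _ => Q)) (l : Fin (d + 1)) :
    ∀ᵐ x ∂Q, ∫ y, condCentred Q h l (x, y) ∂(Measure.pi fun _ : Fin d => Q) = 0 := by
  filter_upwards [(integrable_comp_insertNth hi l).prod_right_ae] with x hx
  simp only [condCentred]
  rw [integral_sub hx (integrable_const _)]
  simp [condKernel]

end CondCentred

section SecondMoments

variable {Ω S : Type*} [MeasurableSpace Ω] [MeasurableSpace S] {d n : ℕ} {μ : Measure Ω}
  {X : Fin n → Ω → S} {Q : Measure S} {h : (Fin (d + 1) → S) → ℝ} {B : ℝ}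

lemma integral_sub_sq_le {f g : Ω → ℝ} (hf : MemLp f 2 μ) (hg : MemLp g 2 μ) :
    ∫ ω, (f ω - g ω) ^ 2 ∂μ ≤ 2 * (∫ ω, f ω ^ 2 ∂μ + ∫ ω, g ω ^ 2 ∂μ) := by
  rw [← integral_add hf.integrable_sq hg.integrable_sq, ← integral_const_mul]
  refine integral_mono (hf.sub hg).integrable_sq
    ((hf.integrable_sq.add hg.integrable_sq).const_mul 2) fun ω => ?_
  simp only
  nlinarith [sq_nonneg (f ω + g ω)]

/-- The second moments of `h`, at independent draws from `Q` and at every tuple of sample points,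
repeated indices included, are bounded by `B`. -/
structure SecondMomentBound (μ : Measure Ω) (X : Fin n → Ω → S) (Q : Measure S)
    (h : (Fin (d + 1) → S) → ℝ) (B : ℝ) : Prop where
  memLp : ∀ I : Fin (d + 1) → Fin n, MemLp (fun ω => h fun k => X (I k) ω) 2 μ
  le : ∀ I : Fin (d + 1) → Fin n, ∫ ω, h (fun k => X (I k) ω) ^ 2 ∂μ ≤ B
  memLp_pi : MemLp h 2 (Measure.pi fun _ => Q)
  pi_le : ∫ z, h z ^ 2 ∂(Measure.pi fun _ => Q) ≤ B

namespace SecondMomentBound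

lemma nonneg (hB : SecondMomentBound μ X Q h B) : 0 ≤ B :=
  (integral_nonneg fun _ => sq_nonneg _).trans hB.pi_le

lemma integrable_integral_empirical_sq [NeZero n] (hB : SecondMomentBound μ X Q h B)
    (hh : Measurable h) :
    Integrable (fun ω => ∫ z, h z ^ 2 ∂(Measure.pi fun _ => empirical fun i => X i ω)) μ := by
  simp only [integral_pi_empirical _ (hh.pow_const 2)]
  exact (integrable_finsetSum _ fun I _ => (hB.memLp I).integrable_sq).const_mul _

lemma integral_integral_empirical_sq_le [NeZero n] [IsProbabilityMeasure μ]
    (hB : SecondMomentBound μ X Q h B) (hs : IsSample μ X Q) (hh : Measurable h) :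
    ∫ ω, ∫ z, h z ^ 2 ∂(Measure.pi fun _ => empirical fun i => X i ω) ∂μ ≤
      ∫ z, h z ^ 2 ∂(Measure.pi fun _ => Q) + (d + 1) ^ 2 * B * (n : ℝ)⁻¹ := by
  classical
  have hn : (0 : ℝ) < n := by exact_mod_cast NeZero.pos n
  have hB0 := hB.nonneg
  have hcard : ((Finset.univ.filter fun I : Fin (d + 1) → Fin n =>
      ¬ Function.Injective I).card : ℝ) ≤ (d + 1) ^ 2 * (n : ℝ)⁻¹ * n ^ (d + 1) := by
    have := card_mul_card_not_injective_le (ι := Fin (d + 1)) (α := Fin n)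
    simp only [Fintype.card_fin] at this
    rw [← div_eq_mul_inv, div_mul_eq_mul_div, le_div_iff₀' hn]
    norm_cast
    convert this
  have hle : ∀ I : Fin (d + 1) → Fin n, ∫ ω, h (fun k => X (I k) ω) ^ 2 ∂μ ≤
      ∫ z, h z ^ 2 ∂(Measure.pi fun _ => Q) + if ¬ Function.Injective I then B else 0 := fun I => by
    split_ifs with hI
    · rw [add_zero]
      exact (integral_comp_of_measurePreserving (f := fun z => h z ^ 2)
        (hs.measurePreserving_tuple hI) (hh.pow_const 2).aestronglyMeasurable).le
    · exact (hB.le I).trans (le_add_of_nonneg_left (integral_nonneg fun _ => sq_nonneg _))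
  simp only [integral_pi_empirical _ (hh.pow_const 2), Fintype.card_fin]
  rw [integral_const_mul, integral_finsetSum _ fun I _ => (hB.memLp I).integrable_sq,
    ← mul_le_mul_iff_right₀ (show 0 < (n : ℝ) ^ (d + 1) by positivity), mul_inv_cancel_left₀
    (by positivity)]
  refine (Finset.sum_le_sum fun I _ => hle I).trans ?_
  rw [Finset.sum_add_distrib, ← Finset.sum_filter, Finset.sum_const, Finset.sum_const, nsmul_eq_mul,
    nsmul_eq_mul, Finset.card_univ, Fintype.card_fun, Fintype.card_fin, Fintype.card_fin, mul_add,
    Nat.cast_pow]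
  refine add_le_add le_rfl ((mul_le_mul_of_nonneg_right hcard hB0).trans_eq ?_)
  ring

variable [IsProbabilityMeasure Q]

lemma memLp_condKernel_comp (hB : SecondMomentBound μ X Q h B) (hs : IsSample μ X Q)
    (hh : Measurable h) (l : Fin (d + 1)) (j : Fin n) :
    MemLp (fun ω => condKernel Q h l (X j ω)) 2 μ :=
  (memLp_condKernel hh one_le_two hB.memLp_pi l).comp_measurePreserving (hs.measurePreserving j)

lemma memLp_condCentred (hB : SecondMomentBound μ X Q h B) (hs : IsSample μ X Q)
    (hh : Measurable h) (l : Fin (d + 1)) (j : Fin n) (J : Fin d → Fin n) :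
    MemLp (fun ω => condCentred Q h l (X j ω, fun k => X (J k) ω)) 2 μ := by
  simp only [condCentred_comp X]
  exact (hB.memLp _).sub (hB.memLp_condKernel_comp hs hh l j)

lemma integral_condCentred_sq_le (hB : SecondMomentBound μ X Q h B) (hs : IsSample μ X Q)
    (hh : Measurable h) (l : Fin (d + 1)) (j : Fin n) (J : Fin d → Fin n) :
    ∫ ω, condCentred Q h l (X j ω, fun k => X (J k) ω) ^ 2 ∂μ ≤ 4 * B := by
  have hcond : ∫ ω, condKernel Q h l (X j ω) ^ 2 ∂μ ≤ B := by
    rw [integral_comp_of_measurePreserving (f := fun x => condKernel Q h l x ^ 2)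
      (hs.measurePreserving j) ((measurable_condKernel hh l).pow_const 2).aestronglyMeasurable]
    exact (integral_condKernel_pow_le hh (mod_cast hB.memLp_pi) even_two two_ne_zero l).trans
      hB.pi_le
  simp only [condCentred_comp X]
  exact (integral_sub_sq_le (hB.memLp _) (hB.memLp_condKernel_comp hs hh l j)).trans
    (by linarith [hB.le (Fin.insertNth (α := fun _ => Fin n) l j J)])

lemma memLp_condKernel_empirical_sub [NeZero n] (hB : SecondMomentBound μ X Q h B)
    (hs : IsSample μ X Q) (hh : Measurable h) (l : Fin (d + 1)) (j : Fin n) :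
    MemLp (fun ω => condKernel (empirical fun i => X i ω) h l (X j ω) -
      condKernel Q h l (X j ω)) 2 μ := by
  simp only [condKernel_empirical_sub hh l]
  exact (memLp_finsetSum _ fun J _ => hB.memLp_condCentred hs hh l j J).const_mul _

variable [IsProbabilityMeasure μ]

open scoped Classical in
lemma integral_condCentred_mul_le (hB : SecondMomentBound μ X Q h B) (hs : IsSample μ X Q)
    (hh : Measurable h) (l : Fin (d + 1)) (j : Fin n) (J J' : Fin d → Fin n) :
    ∫ ω, condCentred Q h l (X j ω, fun k => X (J k) ω) *
        condCentred Q h l (X j ω, fun k => X (J' k) ω) ∂μ ≤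
      if ¬ (Function.Injective J' ∧
        ∀ k r, J' k ≠ Fin.cons (α := fun _ : Fin (d + 1) => Fin n) j J r) then 4 * B else 0 := by
  have hJ := hB.memLp_condCentred hs hh l j J
  have hJ' := hB.memLp_condCentred hs hh l j J'
  split_ifs with hc
  · have hzero := hs.integral_mul_eq_zero_of_ae_integral_eq_zero
      (measurable_condCentred (Q := Q) hh l)
      (ae_integral_condCentred (hB.memLp_pi.integrable one_le_two) l) (v := j) hc.1
      (fun k hk => hc.2 k 0 (by simpa using hk.symm))
      (J := Fin.cons (α := fun _ : Fin (d + 1) => Fin n) j J) (fun r k hr => hc.2 k r hr.symm)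
      (G := fun z => condCentred Q h l (z 0, fun k => z k.succ))
      ((measurable_condCentred hh l).comp (by fun_prop))
    exact le_of_eq (by simpa [mul_comm] using hzero)
  · linarith [two_mul_abs_integral_mul_le hJ hJ', hB.integral_condCentred_sq_le hs hh l j J,
      hB.integral_condCentred_sq_le hs hh l j J', le_abs_self (∫ ω,
        condCentred Q h l (X j ω, fun k => X (J k) ω) *
          condCentred Q h l (X j ω, fun k => X (J' k) ω) ∂μ)]

lemma sum_integral_condCentred_mul_le [NeZero n] (hB : SecondMomentBound μ X Q h B)
    (hs : IsSample μ X Q) (hh : Measurable h) (l : Fin (d + 1)) (j : Fin n) (J : Fin d → Fin n) :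
    ∑ J' : Fin d → Fin n, ∫ ω, condCentred Q h l (X j ω, fun k => X (J k) ω) *
        condCentred Q h l (X j ω, fun k => X (J' k) ω) ∂μ ≤
      4 * (2 * d ^ 2 + d) * B * (n : ℝ)⁻¹ * n ^ d := by
  classical
  have hn : (0 : ℝ) < n := by exact_mod_cast NeZero.pos n
  have hB0 := hB.nonneg
  have hcard : (n : ℝ) * ((Finset.univ.filter fun J' : Fin d → Fin n => ¬ (Function.Injective J' ∧
      ∀ k r, J' k ≠ Fin.cons (α := fun _ : Fin (d + 1) => Fin n) j J r)).card : ℝ) ≤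
      ((d : ℝ) ^ 2 + d * (d + 1)) * (n : ℝ) ^ d := by
    have := card_mul_card_not_injective_or_meets_le (ι := Fin d)
      (Fin.cons (α := fun _ : Fin (d + 1) => Fin n) j J)
    simp only [Fintype.card_fin] at this
    exact_mod_cast this
  refine (Finset.sum_le_sum fun J' _ => hB.integral_condCentred_mul_le hs hh l j J J').trans ?_
  rw [← Finset.sum_filter, Finset.sum_const, nsmul_eq_mul, ← mul_le_mul_iff_right₀ hn,
    ← mul_assoc]
  refine (mul_le_mul_of_nonneg_right hcard (show 0 ≤ 4 * B by positivity)).trans_eq ?_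
  field_simp
  ring

lemma integral_condKernel_empirical_sub_sq_le [NeZero n] (hB : SecondMomentBound μ X Q h B)
    (hs : IsSample μ X Q) (hh : Measurable h) (l : Fin (d + 1)) (j : Fin n) :
    ∫ ω, (condKernel (empirical fun i => X i ω) h l (X j ω) - condKernel Q h l (X j ω)) ^ 2 ∂μ ≤
      4 * (2 * d ^ 2 + d) * B * (n : ℝ)⁻¹ := by
  have hint : ∀ J J' : Fin d → Fin n, Integrable (fun ω =>
      condCentred Q h l (X j ω, fun k => X (J k) ω) *
        condCentred Q h l (X j ω, fun k => X (J' k) ω)) μ := fun J J' =>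
    (hB.memLp_condCentred hs hh l j J).integrable_mul (hB.memLp_condCentred hs hh l j J')
  calc _ = ∫ ω, ((n : ℝ) ^ d)⁻¹ ^ 2 * ∑ J : Fin d → Fin n, ∑ J' : Fin d → Fin n,
        condCentred Q h l (X j ω, fun k => X (J k) ω) *
          condCentred Q h l (X j ω, fun k => X (J' k) ω) ∂μ := by
        simp only [condKernel_empirical_sub hh l, mul_pow, sq (∑ _ : Fin d → Fin n, _),
          Finset.sum_mul_sum]
    _ = ((n : ℝ) ^ d)⁻¹ ^ 2 * ∑ J : Fin d → Fin n, ∑ J' : Fin d → Fin n,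
        ∫ ω, condCentred Q h l (X j ω, fun k => X (J k) ω) *
          condCentred Q h l (X j ω, fun k => X (J' k) ω) ∂μ := by
        rw [integral_const_mul, integral_finsetSum _ fun J _ => integrable_finsetSum _
          fun J' _ => hint J J']
        simp only [integral_finsetSum _ fun J' _ => hint _ J']
    _ ≤ ((n : ℝ) ^ d)⁻¹ ^ 2 * ∑ _J : Fin d → Fin n,
        4 * (2 * d ^ 2 + d) * B * (n : ℝ)⁻¹ * n ^ d := by
        gcongr with J
        exact hB.sum_integral_condCentred_mul_le hs hh l j J
    _ = _ := by
        have : (n : ℝ) ≠ 0 := NeZero.ne _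
        simp only [Finset.sum_const, Finset.card_univ, Fintype.card_fun, Fintype.card_fin,
          nsmul_eq_mul, Nat.cast_pow]
        field_simp

end SecondMomentBound

end SecondMoments

section ProjError

variable {Ω S : Type*} [MeasurableSpace Ω] [MeasurableSpace S] {d n : ℕ} {μ : Measure Ω}
  {X : Fin n → Ω → S} {Q : Measure S} {h : (Fin (d + 1) → S) → ℝ} {B : ℝ}

/-- The mean square distance, over the sample, between the first order projections of `h` under
the empirical distribution and those under `Q`. -/
noncomputable def projError (Q : Measure S) (h : (Fin (d + 1) → S) → ℝ) (x : Fin n → S) : ℝ :=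
  (n : ℝ)⁻¹ * ∑ j, ∑ l, (projKernel (empirical x) h l (x j) - projKernel Q h l (x j)) ^ 2

lemma SecondMomentBound.memLp_mean_projKernel [IsProbabilityMeasure Q]
    (hB : SecondMomentBound μ X Q h B) (hs : IsSample μ X Q) (hh : Measurable h)
    (l : Fin (d + 1)) : MemLp (fun ω => (n : ℝ)⁻¹ * ∑ j, projKernel Q h l (X j ω)) 2 μ :=
  (memLp_finsetSum _ fun j _ => (memLp_projKernel hh one_le_two hB.memLp_pi
    l).comp_measurePreserving (hs.measurePreserving j)).const_mul _

variable [NeZero n]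

lemma projKernel_empirical_sub (hh : Measurable h) (l : Fin (d + 1)) (x : Fin n → S) (y : S) :
    projKernel (empirical x) h l y - projKernel Q h l y =
      (condKernel (empirical x) h l y - condKernel Q h l y) -
        (n : ℝ)⁻¹ * ∑ j, (condKernel (empirical x) h l (x j) - condKernel Q h l (x j)) -
        (n : ℝ)⁻¹ * ∑ j, projKernel Q h l (x j) := by
  have hn : (n : ℝ) ≠ 0 := NeZero.ne _
  have hmean : meanKernel (empirical x) h =
      (n : ℝ)⁻¹ * ∑ j, condKernel (empirical x) h l (x j) := by
    rw [← integral_condKernel ((memLp_pi_empirical x hh 1).integrable le_rfl) l,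
      integral_empirical x (measurable_condKernel hh l)]
  simp only [projKernel, hmean, Finset.sum_sub_distrib, Finset.sum_const, Finset.card_univ,
    Fintype.card_fin, nsmul_eq_mul]
  field_simp
  ring

lemma inv_mul_sum_sub_mean_sub_sq_le (u : Fin n → ℝ) (g : ℝ) :
    (n : ℝ)⁻¹ * ∑ j, (u j - (n : ℝ)⁻¹ * ∑ k, u k - g) ^ 2 ≤ (n : ℝ)⁻¹ * ∑ j, u j ^ 2 + g ^ 2 := by
  have hn : (n : ℝ) ≠ 0 := NeZero.ne _
  set w := (n : ℝ)⁻¹ * ∑ k, u k with hw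
  have hsum : ∑ k, u k = n * w := by rw [hw, mul_inv_cancel_left₀ hn]
  have hexpand : ∑ j, (u j - w - g) ^ 2 = ∑ j, u j ^ 2 - n * w ^ 2 + n * g ^ 2 := by
    calc ∑ j, (u j - w - g) ^ 2 = ∑ j, (u j ^ 2 - 2 * (w + g) * u j + (w + g) ^ 2) :=
          Finset.sum_congr rfl fun j _ => by ring
      _ = ∑ j, u j ^ 2 - 2 * (w + g) * (n * w) + n * (w + g) ^ 2 := by
          simp [Finset.sum_add_distrib, Finset.sum_sub_distrib, ← Finset.mul_sum, hsum]
      _ = _ := by ring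
  calc _ = (n : ℝ)⁻¹ * ∑ j, u j ^ 2 + g ^ 2 - w ^ 2 := by rw [hexpand]; field_simp; ring
    _ ≤ _ := sub_le_self _ (sq_nonneg w)

lemma projError_le (hh : Measurable h) (x : Fin n → S) :
    projError Q h x ≤ ∑ l, ((n : ℝ)⁻¹ *
      ∑ j, (condKernel (empirical x) h l (x j) - condKernel Q h l (x j)) ^ 2 +
        ((n : ℝ)⁻¹ * ∑ j, projKernel Q h l (x j)) ^ 2) := by
  rw [projError, Finset.sum_comm, Finset.mul_sum]
  refine Finset.sum_le_sum fun l _ => ?_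
  simp only [projKernel_empirical_sub hh l x]
  exact inv_mul_sum_sub_mean_sub_sq_le _ _

namespace SecondMomentBound

variable [IsProbabilityMeasure Q]

lemma integrable_projError (hB : SecondMomentBound μ X Q h B) (hs : IsSample μ X Q)
    (hh : Measurable h) : Integrable (fun ω => projError Q h fun i => X i ω) μ := by
  refine (integrable_finsetSum _ fun j _ => integrable_finsetSum _ fun l _ => ?_).const_mul _
  simp only [projKernel_empirical_sub hh l]
  exact (((hB.memLp_condKernel_empirical_sub hs hh l j).sub ((memLp_finsetSum _ fun k _ =>
    hB.memLp_condKernel_empirical_sub hs hh l k).const_mul _)).sub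
      (hB.memLp_mean_projKernel hs hh l)).integrable_sq

variable [IsProbabilityMeasure μ]

lemma integral_mean_projKernel_sq_le (hB : SecondMomentBound μ X Q h B) (hs : IsSample μ X Q)
    (hh : Measurable h) (l : Fin (d + 1)) :
    ∫ ω, ((n : ℝ)⁻¹ * ∑ j, projKernel Q h l (X j ω)) ^ 2 ∂μ ≤ 4 * B * (n : ℝ)⁻¹ := by
  have hn : (n : ℝ) ≠ 0 := NeZero.ne _
  have hproj : ∫ x, projKernel Q h l x ^ 2 ∂Q ≤ 4 * B :=
    (integral_projKernel_pow_le hh (mod_cast hB.memLp_pi) even_two two_ne_zero l).trans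
      (by linarith [hB.pi_le])
  simp only [mul_pow]
  rw [integral_const_mul, hs.integral_sum_comp_sq (f := fun _ => projKernel Q h l)
    (fun _ => measurable_projKernel hh l) (fun _ => memLp_projKernel hh one_le_two hB.memLp_pi l)
    fun _ => integral_projKernel hh (hB.memLp_pi.integrable one_le_two) l]
  calc _ = (∫ x, projKernel Q h l x ^ 2 ∂Q) * (n : ℝ)⁻¹ := by
        simp only [Finset.sum_const, Finset.card_univ, Fintype.card_fin, nsmul_eq_mul]
        field_simp
    _ ≤ _ := by gcongr

lemma integral_projError_le (hB : SecondMomentBound μ X Q h B) (hs : IsSample μ X Q)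
    (hh : Measurable h) :
    ∫ ω, projError Q h (fun i => X i ω) ∂μ ≤
      (d + 1) * (8 * d ^ 2 + 4 * d + 4) * B * (n : ℝ)⁻¹ := by
  have hn : (n : ℝ) ≠ 0 := NeZero.ne _
  have hcond := fun l j => (hB.memLp_condKernel_empirical_sub hs hh l j).integrable_sq
  have hmean := fun l => (hB.memLp_mean_projKernel hs hh l).integrable_sq
  have hcond' := fun l =>
    (integrable_finsetSum Finset.univ fun j _ => hcond l j).const_mul (n : ℝ)⁻¹
  have hl : ∀ l, ∫ ω, ((n : ℝ)⁻¹ * ∑ j, (condKernel (empirical fun i => X i ω) h l (X j ω) -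
      condKernel Q h l (X j ω)) ^ 2 + ((n : ℝ)⁻¹ * ∑ j, projKernel Q h l (X j ω)) ^ 2) ∂μ ≤
      (n : ℝ)⁻¹ * ∑ _j : Fin n, 4 * (2 * d ^ 2 + d) * B * (n : ℝ)⁻¹ + 4 * B * (n : ℝ)⁻¹ := by
    intro l
    rw [integral_add (hcond' l) (hmean l), integral_const_mul,
      integral_finsetSum _ fun j _ => hcond l j]
    gcongr with j
    exacts [hB.integral_condKernel_empirical_sub_sq_le hs hh l j,
      hB.integral_mean_projKernel_sq_le hs hh l]
  refine (integral_mono (hB.integrable_projError hs hh) (integrable_finsetSum _ fun l _ =>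
    (hcond' l).add (hmean l)) fun ω => projError_le hh _).trans ?_
  rw [integral_finsetSum _ fun l _ => (hcond' l).add (hmean l)]
  refine (Finset.sum_le_sum fun l _ => hl l).trans_eq ?_
  simp only [Finset.sum_const, Finset.card_univ, Fintype.card_fin, nsmul_eq_mul, Nat.cast_add,
    Nat.cast_one]
  field_simp
  ring

end SecondMomentBound

end ProjError

section FourthMoments

variable {α : Type*} [MeasurableSpace α] {ν : Measure α} {f : α → ℝ}

lemma memLp_sq_of_memLp_four (hf : MemLp f 4 ν) : MemLp (fun x => f x ^ 2) 2 ν := by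
  have h42 : (4 : ℝ≥0∞) / 2 = 2 := by
    rw [show (4 : ℝ≥0∞) = 2 * 2 by norm_num]
    exact ENNReal.mul_div_cancel_right two_ne_zero ENNReal.ofNat_ne_top
  simpa [h42] using hf.norm_rpow_div 2

lemma integral_sq_le_rpow_half [IsProbabilityMeasure ν] (hf : MemLp f 4 ν) {M : ℝ}
    (hM : ∫ x, f x ^ 4 ∂ν ≤ M) : ∫ x, f x ^ 2 ∂ν ≤ M ^ (1 / 2 : ℝ) := by
  have hvar := variance_nonneg (fun x => f x ^ 2) ν
  rw [variance_eq_sub (memLp_sq_of_memLp_four hf)] at hvar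
  simp only [Pi.pow_apply, ← pow_mul] at hvar
  rw [← Real.sqrt_eq_rpow]
  exact Real.le_sqrt_of_sq_le (by linarith)

lemma memLp_of_lintegral_ofReal_pow_ne_top {k : ℕ} (hf : AEStronglyMeasurable f ν) (hk : Even k)
    (hk0 : k ≠ 0) (h : ∫⁻ x, ENNReal.ofReal (f x ^ k) ∂ν ≠ ∞) : MemLp f k ν := by
  refine ⟨hf, (eLpNorm_lt_top_iff_lintegral_rpow_enorm_lt_top (mod_cast hk0)
    (ENNReal.natCast_ne_top k)).2 ?_⟩
  convert h.lt_top using 3 with x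
  rw [ENNReal.toReal_natCast, ENNReal.rpow_natCast, ← hk.pow_abs,
    ENNReal.ofReal_pow (abs_nonneg _), Real.enorm_eq_ofReal_abs]

lemma integral_le_of_lintegral_ofReal_le (hf : AEStronglyMeasurable f ν) (hf0 : ∀ x, 0 ≤ f x)
    {b : ℝ} (hb : 0 ≤ b) (h : ∫⁻ x, ENNReal.ofReal (f x) ∂ν ≤ ENNReal.ofReal b) :
    ∫ x, f x ∂ν ≤ b := by
  rw [integral_eq_lintegral_of_nonneg_ae (ae_of_all _ hf0) hf]
  exact ENNReal.toReal_le_of_le_ofReal hb h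

end FourthMoments

section SquaredProjections

variable {Ω S : Type*} [MeasurableSpace Ω] [MeasurableSpace S] {d n : ℕ} {μ : Measure Ω}
  {X : Fin n → Ω → S} {Q : Measure S} {h : (Fin (d + 1) → S) → ℝ}

/-- The sum over `i` of the squares of the first order projections at `x`, normalised by `n * s`. -/
noncomputable def normSum (Q : Measure S) (a : (Fin (d + 1) → Fin n) → ℝ)
    (h : (Fin (d + 1) → S) → ℝ) (s : ℝ) (x : S) : ℝ :=
  ∑ i, (projSum Q a h i x / (n * s)) ^ 2

/-- The average of `normSum` over the points of a sample. -/
noncomputable def normAvg (Q : Measure S) (a : (Fin (d + 1) → Fin n) → ℝ)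
    (h : (Fin (d + 1) → S) → ℝ) (s : ℝ) (x : Fin n → S) : ℝ :=
  (n : ℝ)⁻¹ * ∑ j, normSum Q a h s (x j)

/-- The Lyapunov sum of order `K`, for kernels whose fourth moment is at most `M`. -/
noncomputable def lyapunovSum (K : ℕ) (a : (Fin (d + 1) → Fin n) → ℝ) (M s : ℝ) : ℝ :=
  ∑ i, (absWeight a i * M ^ (1 / 4 : ℝ) / (n * s)) ^ K

lemma normAvg_eq (Q : Measure S) (a : (Fin (d + 1) → Fin n) → ℝ) (h : (Fin (d + 1) → S) → ℝ)
    (s : ℝ) (x : Fin n → S) :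
    normAvg Q a h s x = (n : ℝ)⁻¹ * ∑ i, ∑ j, (projSum Q a h i (x j) / (n * s)) ^ 2 := by
  simp only [normAvg, normSum]
  rw [Finset.sum_comm]

lemma lyapunovSum_four (a : (Fin (d + 1) → Fin n) → ℝ) {M : ℝ} (hM : 0 ≤ M) (s : ℝ) :
    lyapunovSum 4 a M s = M / (n * s) ^ 4 * ∑ i, absWeight a i ^ 4 := by
  have hM4 : (M ^ (1 / 4 : ℝ)) ^ 4 = M := by
    rw [← Real.rpow_natCast, ← Real.rpow_mul hM]
    norm_num
  rw [lyapunovSum, Finset.mul_sum]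
  exact Finset.sum_congr rfl fun i _ => by rw [div_pow, mul_pow, hM4]; ring

lemma projSum_pow_four_le (Q : Measure S) (a : (Fin (d + 1) → Fin n) → ℝ)
    (h : (Fin (d + 1) → S) → ℝ) (i : Fin n) (x : S) :
    projSum Q a h i x ^ 4 ≤
      ((d + 1) * absWeight a i ^ 2) ^ 2 * ((d + 1) * ∑ l, projKernel Q h l x ^ 4) := by
  have hsq : projSum Q a h i x ^ 2 ≤
      (d + 1) * absWeight a i ^ 2 * ∑ l, projKernel Q h l x ^ 2 :=
    (Finset.sum_mul_sq_le_sq_mul_sq _ _ _).trans (by gcongr; exact sum_weightCoef_sq_le a i)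
  have hcard : (∑ l, projKernel Q h l x ^ 2) ^ 2 ≤ (d + 1) * ∑ l, projKernel Q h l x ^ 4 := by
    have hcs := sq_sum_le_card_mul_sum_sq (s := Finset.univ) (f := fun l => projKernel Q h l x ^ 2)
    simp only [Finset.card_univ, Fintype.card_fin, ← pow_mul] at hcs
    exact_mod_cast hcs
  calc projSum Q a h i x ^ 4 = (projSum Q a h i x ^ 2) ^ 2 := by ring
    _ ≤ ((d + 1) * absWeight a i ^ 2 * ∑ l, projKernel Q h l x ^ 2) ^ 2 := by gcongr
    _ = ((d + 1) * absWeight a i ^ 2) ^ 2 * (∑ l, projKernel Q h l x ^ 2) ^ 2 := mul_pow ..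
    _ ≤ _ := by gcongr

variable [IsProbabilityMeasure Q]

lemma measurable_normSum (hh : Measurable h) (a : (Fin (d + 1) → Fin n) → ℝ) (s : ℝ) :
    Measurable (normSum Q a h s) :=
  Finset.measurable_fun_sum _ fun i _ => ((measurable_projSum hh a i).div_const _).pow_const 2

lemma memLp_projSum_div {p : ℝ≥0∞} (hh : Measurable h) (hp : 1 ≤ p)
    (hhp : MemLp h p (Measure.pi fun _ => Q)) (a : (Fin (d + 1) → Fin n) → ℝ) (c : ℝ)
    (i : Fin n) : MemLp (fun x => projSum Q a h i x / c) p Q := by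
  simpa only [div_eq_mul_inv] using (memLp_projSum hh hp hhp a i).mul_const c⁻¹

lemma memLp_normSum (hh : Measurable h) (hh4 : MemLp h 4 (Measure.pi fun _ => Q))
    (a : (Fin (d + 1) → Fin n) → ℝ) (s : ℝ) : MemLp (normSum Q a h s) 2 Q :=
  memLp_finsetSum _ fun i _ =>
    memLp_sq_of_memLp_four (memLp_projSum_div hh (by norm_num) hh4 a _ i)

lemma integrable_normSum (hh : Measurable h) (hh2 : MemLp h 2 (Measure.pi fun _ => Q))
    (a : (Fin (d + 1) → Fin n) → ℝ) (s : ℝ) : Integrable (normSum Q a h s) Q :=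
  integrable_finsetSum _ fun i _ => (memLp_projSum_div hh one_le_two hh2 a _ i).integrable_sq

lemma integral_projSum_pow_four_le (hh : Measurable h)
    (hh4 : MemLp h 4 (Measure.pi fun _ => Q)) {M : ℝ}
    (hM : ∫ z, h z ^ 4 ∂(Measure.pi fun _ => Q) ≤ M) (a : (Fin (d + 1) → Fin n) → ℝ)
    (i : Fin n) :
    ∫ x, projSum Q a h i x ^ 4 ∂Q ≤ 16 * (d + 1) ^ 4 * M * absWeight a i ^ 4 := by
  have hcast : MemLp h (4 : ℕ) (Measure.pi fun _ => Q) := mod_cast hh4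
  have hint : ∀ l, Integrable (fun x => projKernel Q h l x ^ 4) Q := fun l =>
    integrable_pow_of_memLp (memLp_projKernel hh (by norm_num) hcast l) four_ne_zero
  calc ∫ x, projSum Q a h i x ^ 4 ∂Q
      ≤ ∫ x, ((d + 1) * absWeight a i ^ 2) ^ 2 * ((d + 1) * ∑ l, projKernel Q h l x ^ 4) ∂Q :=
        integral_mono
          (integrable_pow_of_memLp (memLp_projSum hh (by norm_num) hcast a i) four_ne_zero)
          (((integrable_finsetSum _ fun l _ => hint l).const_mul _).const_mul _)
          (projSum_pow_four_le Q a h i)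
    _ = ((d + 1) * absWeight a i ^ 2) ^ 2 * ((d + 1) * ∑ l, ∫ x, projKernel Q h l x ^ 4 ∂Q) := by
        rw [integral_const_mul, integral_const_mul, integral_finsetSum _ fun l _ => hint l]
    _ ≤ ((d + 1) * absWeight a i ^ 2) ^ 2 * ((d + 1) * ∑ _l : Fin (d + 1), 2 ^ 4 * M) := by
        gcongr with l
        exact (integral_projKernel_pow_le hh hcast (by decide) four_ne_zero l).trans (by gcongr)
    _ = _ := by
        simp only [Finset.sum_const, Finset.card_univ, Fintype.card_fin, nsmul_eq_mul,
          Nat.cast_add, Nat.cast_one]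
        ring

lemma integral_normSum_sq_le (hh : Measurable h) (hh4 : MemLp h 4 (Measure.pi fun _ => Q))
    {M : ℝ} (hM0 : 0 ≤ M) (hM : ∫ z, h z ^ 4 ∂(Measure.pi fun _ => Q) ≤ M)
    (a : (Fin (d + 1) → Fin n) → ℝ) (s : ℝ) :
    ∫ x, normSum Q a h s x ^ 2 ∂Q ≤ n * (16 * (d + 1) ^ 4 * lyapunovSum 4 a M s) := by
  have hint : ∀ i, Integrable (fun x => (projSum Q a h i x / (n * s)) ^ 4) Q := fun i =>
    integrable_pow_of_memLp (mod_cast memLp_projSum_div hh (by norm_num) hh4 a _ i) four_ne_zero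
  calc ∫ x, normSum Q a h s x ^ 2 ∂Q
      ≤ ∫ x, n * ∑ i, (projSum Q a h i x / (n * s)) ^ 4 ∂Q := by
        refine integral_mono (memLp_normSum hh hh4 a s).integrable_sq
          ((integrable_finsetSum _ fun i _ => hint i).const_mul _) fun x => ?_
        have hcs := sq_sum_le_card_mul_sum_sq (s := Finset.univ)
          (f := fun i => (projSum Q a h i x / (n * s)) ^ 2)
        simpa only [normSum, Finset.card_univ, Fintype.card_fin, ← pow_mul] using hcs
    _ = n * ∑ i, (∫ x, projSum Q a h i x ^ 4 ∂Q) / (n * s) ^ 4 := by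
        rw [integral_const_mul, integral_finsetSum _ fun i _ => hint i]
        simp only [div_pow, integral_div]
    _ ≤ n * ∑ i, 16 * (d + 1) ^ 4 * M * absWeight a i ^ 4 / (n * s) ^ 4 := by
        gcongr with i
        exact integral_projSum_pow_four_le hh hh4 hM a i
    _ = _ := by
        rw [lyapunovSum_four a hM0, ← Finset.sum_div, ← Finset.mul_sum]
        ring

namespace IsSample

lemma integrable_normAvg (hs : IsSample μ X Q) (hh : Measurable h)
    (hh2 : MemLp h 2 (Measure.pi fun _ => Q)) (a : (Fin (d + 1) → Fin n) → ℝ) (s : ℝ) :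
    Integrable (fun ω => normAvg Q a h s fun i => X i ω) μ :=
  (integrable_finsetSum _ fun j _ => (hs.measurePreserving j).integrable_comp_of_integrable
    (integrable_normSum hh hh2 a s)).const_mul _

lemma memLp_sum_projSum_div (hs : IsSample μ X Q) (hh : Measurable h)
    (hh2 : MemLp h 2 (Measure.pi fun _ => Q)) (a : (Fin (d + 1) → Fin n) → ℝ) (c : ℝ)
    (i : Fin n) : MemLp (fun ω => ∑ j, projSum Q a h i (X j ω) / c) 2 μ :=
  memLp_finsetSum _ fun j _ => (memLp_projSum_div hh one_le_two hh2 a c i).comp_measurePreserving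
    (hs.measurePreserving j)

variable [IsProbabilityMeasure μ]

lemma integral_normSum (hs : IsSample μ X Q) (hh : Measurable h)
    (hh2 : MemLp h 2 (Measure.pi fun _ => Q)) (a : (Fin (d + 1) → Fin n) → ℝ) (s : ℝ) :
    ∫ x, normSum Q a h s x ∂Q = V μ a h X / s ^ 2 := by
  simp only [normSum]
  rw [integral_finsetSum _ fun i _ =>
    (memLp_projSum_div hh one_le_two hh2 a _ i).integrable_sq, hs.V_eq hh hh2]
  simp only [div_pow, integral_div]
  rw [← Finset.sum_div, mul_pow, div_mul_eq_div_div, div_eq_inv_mul (∑ i, _)]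

lemma integral_normAvg [NeZero n] (hs : IsSample μ X Q) (hh : Measurable h)
    (hh2 : MemLp h 2 (Measure.pi fun _ => Q)) (a : (Fin (d + 1) → Fin n) → ℝ) (s : ℝ) :
    ∫ ω, normAvg Q a h s (fun i => X i ω) ∂μ = V μ a h X / s ^ 2 := by
  have hn : (n : ℝ) ≠ 0 := NeZero.ne _
  have hj : ∀ j, ∫ ω, normSum Q a h s (X j ω) ∂μ = V μ a h X / s ^ 2 := fun j => by
    rw [integral_comp_of_measurePreserving (hs.measurePreserving j)
      (measurable_normSum hh a s).aestronglyMeasurable, hs.integral_normSum hh hh2]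
  have hint : ∀ j, Integrable (fun ω => normSum Q a h s (X j ω)) μ := fun j =>
    (hs.measurePreserving j).integrable_comp_of_integrable (integrable_normSum hh hh2 a s)
  simp only [normAvg]
  rw [integral_const_mul, integral_finsetSum _ fun j _ => hint j]
  simp only [hj, Finset.sum_const, Finset.card_univ, Fintype.card_fin, nsmul_eq_mul]
  rw [inv_mul_cancel_left₀ hn]

lemma integrable_normAvg_sub_sq (hs : IsSample μ X Q) (hh : Measurable h)
    (hh4 : MemLp h 4 (Measure.pi fun _ => Q)) (a : (Fin (d + 1) → Fin n) → ℝ) (s c : ℝ) :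
    Integrable (fun ω => (normAvg Q a h s (fun i => X i ω) - c) ^ 2) μ :=
  (((memLp_finsetSum _ fun j _ => (memLp_normSum hh hh4 a s).comp_measurePreserving
    (hs.measurePreserving j)).const_mul _).sub (memLp_const c)).integrable_sq

lemma integral_normAvg_sub_sq_le [NeZero n] (hs : IsSample μ X Q) (hh : Measurable h)
    (hh4 : MemLp h 4 (Measure.pi fun _ => Q)) {M : ℝ} (hM0 : 0 ≤ M)
    (hM : ∫ z, h z ^ 4 ∂(Measure.pi fun _ => Q) ≤ M) (a : (Fin (d + 1) → Fin n) → ℝ) (s : ℝ) :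
    ∫ ω, (normAvg Q a h s (fun i => X i ω) - V μ a h X / s ^ 2) ^ 2 ∂μ ≤
      16 * (d + 1) ^ 4 * lyapunovSum 4 a M s := by
  have hn : (n : ℝ) ≠ 0 := NeZero.ne _
  have hh2 : MemLp h 2 (Measure.pi fun _ => Q) := hh4.mono_exponent (by norm_num)
  have hG := memLp_normSum hh hh4 a s
  set v := V μ a h X / s ^ 2
  have hmean : ∫ x, normSum Q a h s x ∂Q = v := hs.integral_normSum hh hh2 a s
  have hcentre : ∀ ω, normAvg Q a h s (fun i => X i ω) - v =
      (n : ℝ)⁻¹ * ∑ j, (normSum Q a h s (X j ω) - v) := fun ω => by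
    simp only [normAvg, Finset.sum_sub_distrib, Finset.sum_const, Finset.card_univ,
      Fintype.card_fin, nsmul_eq_mul]
    field_simp
  have hvar : ∫ x, (normSum Q a h s x - v) ^ 2 ∂Q ≤ ∫ x, normSum Q a h s x ^ 2 ∂Q := by
    simpa only [variance_eq_integral hG.1.aemeasurable, hmean, Pi.pow_apply] using
      variance_le_expectation_sq hG.1
  simp only [hcentre, mul_pow]
  rw [integral_const_mul, hs.integral_sum_comp_sq (f := fun _ x => normSum Q a h s x - v)
    (fun _ => (measurable_normSum hh a s).sub_const _) (fun _ => hG.sub (memLp_const _))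
    fun _ => by rw [integral_sub (integrable_normSum hh hh2 a s) (integrable_const _), hmean]; simp]
  calc _ ≤ (n : ℝ)⁻¹ ^ 2 * ∑ _j : Fin n, n * (16 * (d + 1) ^ 4 * lyapunovSum 4 a M s) := by
        gcongr
        exact hvar.trans (integral_normSum_sq_le hh hh4 hM0 hM a s)
    _ = _ := by
        simp only [Finset.sum_const, Finset.card_univ, Fintype.card_fin, nsmul_eq_mul]
        field_simp

lemma integral_sum_sum_projSum_sq (hs : IsSample μ X Q) (hh : Measurable h)
    (hh2 : MemLp h 2 (Measure.pi fun _ => Q)) (a : (Fin (d + 1) → Fin n) → ℝ) (s : ℝ) :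
    ∫ ω, ∑ i, (∑ j, projSum Q a h i (X j ω) / (n * s)) ^ 2 ∂μ = n * (V μ a h X / s ^ 2) := by
  have hi : ∀ i, ∫ ω, (∑ j, projSum Q a h i (X j ω) / (n * s)) ^ 2 ∂μ =
      n * ∫ x, (projSum Q a h i x / (n * s)) ^ 2 ∂Q := fun i => by
    rw [hs.integral_sum_comp_sq (f := fun _ x => projSum Q a h i x / (n * s))
      (fun _ => (measurable_projSum hh a i).div_const _)
      (fun _ => memLp_projSum_div hh one_le_two hh2 a _ i)
      fun _ => by rw [integral_div, integral_projSum hh (hh2.integrable one_le_two), zero_div]]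
    simp
  rw [integral_finsetSum _ fun i _ => (hs.memLp_sum_projSum_div hh hh2 a _ i).integrable_sq,
    ← hs.integral_normSum hh hh2 a s]
  simp only [hi, normSum]
  rw [← Finset.mul_sum, integral_finsetSum _ fun i _ =>
    (memLp_projSum_div hh one_le_two hh2 a _ i).integrable_sq]

end IsSample

end SquaredProjections

section BootstrapVariance

variable {S : Type*} [MeasurableSpace S] {d n : ℕ} {h : (Fin (d + 1) → S) → ℝ}

lemma bootstrapVar_const_mul_uStat {m : ℕ} (c : ℝ) (a : (Fin m → Fin n) → ℝ)
    (h : (Fin m → S) → ℝ) (x : Fin n → S) :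
    bootstrapVar (fun y => c * uStat a h y) x =
      c ^ 2 * variance (U a h fun i (y : Fin n → S) => y i) (bootstrapLaw x) :=
  variance_const_mul c _ _

/-- The contribution of the remainder to the variance of `s⁻¹ * U`, per unit of second moment of
the kernel. -/
noncomputable def remainderFactor (a : (Fin (d + 1) → Fin n) → ℝ) (s : ℝ) : ℝ :=
  s⁻¹ ^ 2 * (sharedWeight 2 2 a * (2 * d + 4) ^ 2)

lemma remainderFactor_nonneg (a : (Fin (d + 1) → Fin n) → ℝ) (s : ℝ) :
    0 ≤ remainderFactor a s := by
  have := sharedWeight_nonneg 2 2 a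
  unfold remainderFactor
  positivity

lemma IsSample.abs_variance_U_sub_V_le {Ω : Type*} [MeasurableSpace Ω] {μ : Measure Ω}
    [IsProbabilityMeasure μ] {X : Fin n → Ω → S} {Q : Measure S} [IsProbabilityMeasure Q]
    (hs : IsSample μ X Q) (hh : Measurable h) (hh2 : MemLp h 2 (Measure.pi fun _ => Q))
    (a : (Fin (d + 1) → Fin n) → ℝ) (s : ℝ) :
    |s⁻¹ ^ 2 * variance (U a h X) μ - V μ a h X / s ^ 2| ≤
      remainderFactor a s * ∫ z, h z ^ 2 ∂(Measure.pi fun _ => Q) := by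
  rw [div_eq_inv_mul, ← inv_pow, ← mul_sub, abs_mul, abs_of_nonneg (sq_nonneg s⁻¹),
    abs_of_nonneg (sub_nonneg.2 (hs.V_le_variance_U hh hh2 a)), remainderFactor, mul_assoc,
    mul_assoc]
  gcongr
  exact sub_le_iff_le_add'.2 (hs.variance_U_le hh hh2 a)

variable [NeZero n]

lemma V_bootstrapLaw_div_sq (hh : Measurable h) (s : ℝ) (a : (Fin (d + 1) → Fin n) → ℝ)
    (x : Fin n → S) :
    V (bootstrapLaw x) a h (fun i (y : Fin n → S) => y i) / s ^ 2 =
      normAvg (empirical x) a h s x := by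
  have : IsProbabilityMeasure (bootstrapLaw x) := by unfold bootstrapLaw; infer_instance
  rw [← (isSample_bootstrapLaw x).integral_normSum hh (memLp_pi_empirical x hh 2),
    integral_empirical x (measurable_normSum hh a s), normAvg]

lemma abs_bootstrapVar_sub_normAvg_le (hh : Measurable h) (s : ℝ)
    (a : (Fin (d + 1) → Fin n) → ℝ) (x : Fin n → S) :
    |bootstrapVar (fun y => s⁻¹ * uStat a h y) x - normAvg (empirical x) a h s x| ≤
      remainderFactor a s * ∫ z, h z ^ 2 ∂(Measure.pi fun _ => empirical x) := by
  have : IsProbabilityMeasure (bootstrapLaw x) := by unfold bootstrapLaw; infer_instance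
  rw [bootstrapVar_const_mul_uStat, ← V_bootstrapLaw_div_sq hh]
  exact (isSample_bootstrapLaw x).abs_variance_U_sub_V_le hh (memLp_pi_empirical x hh 2) a s

end BootstrapVariance

section EmpiricalProjections

variable {S : Type*} {d n : ℕ} [MeasurableSpace S]

lemma abs_sq_sub_sq_le {ε : ℝ} (hε : 0 < ε) (u v : ℝ) :
    |u ^ 2 - v ^ 2| ≤ (1 + ε⁻¹) * (u - v) ^ 2 + ε * v ^ 2 := by
  have hsq : ε⁻¹ * (u - v) ^ 2 + ε * v ^ 2 - 2 * |v * (u - v)| =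
      ε⁻¹ * (|u - v| - ε * |v|) ^ 2 := by
    rw [abs_mul, ← sq_abs (u - v), ← sq_abs v]
    field_simp
    ring
  have hyoung : 0 ≤ ε⁻¹ * (|u - v| - ε * |v|) ^ 2 := by positivity
  calc |u ^ 2 - v ^ 2| = |(u - v) ^ 2 + 2 * (v * (u - v))| := by ring_nf
    _ ≤ (u - v) ^ 2 + 2 * |v * (u - v)| :=
        (abs_add_le _ _).trans_eq (by rw [abs_of_nonneg (sq_nonneg (u - v)), abs_mul 2, abs_two])
    _ ≤ _ := by linarith

/-- The factor by which `projError` bounds the mean squared change of the normalised projections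
when `Q` is replaced by the empirical distribution. -/
noncomputable def projWeight (a : (Fin (d + 1) → Fin n) → ℝ) (s : ℝ) : ℝ :=
  ((n * s) ^ 2)⁻¹ * ((d + 1) * ∑ i, absWeight a i ^ 2)

variable (Q : Measure S) (a : (Fin (d + 1) → Fin n) → ℝ) (h : (Fin (d + 1) → S) → ℝ) (s : ℝ)
  (x : Fin n → S)

lemma projSum_empirical_sub_sq_le (i : Fin n) (y : S) :
    (projSum (empirical x) a h i y - projSum Q a h i y) ^ 2 ≤ (d + 1) * absWeight a i ^ 2 *
      ∑ l, (projKernel (empirical x) h l y - projKernel Q h l y) ^ 2 := by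
  simp only [projSum, ← Finset.sum_sub_distrib, ← mul_sub]
  exact (Finset.sum_mul_sq_le_sq_mul_sq _ _ _).trans (by gcongr; exact sum_weightCoef_sq_le a i)

lemma mean_projSum_empirical_sub_sq_le :
    (n : ℝ)⁻¹ * ∑ i, ∑ j, (projSum (empirical x) a h i (x j) / (n * s) -
        projSum Q a h i (x j) / (n * s)) ^ 2 ≤ projWeight a s * projError Q h x := by
  calc _ ≤ (n : ℝ)⁻¹ * ∑ i, ∑ j, ((d + 1) * absWeight a i ^ 2 *
        ∑ l, (projKernel (empirical x) h l (x j) - projKernel Q h l (x j)) ^ 2) / (n * s) ^ 2 := by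
        simp only [← sub_div, div_pow]
        gcongr with i _ j _
        exact projSum_empirical_sub_sq_le Q a h x i (x j)
    _ = _ := by
        simp only [← Finset.sum_div, ← Finset.mul_sum, ← Finset.sum_mul, projWeight, projError]
        ring

lemma abs_normAvg_empirical_sub_le {ε : ℝ} (hε : 0 < ε) :
    |normAvg (empirical x) a h s x - normAvg Q a h s x| ≤
      (1 + ε⁻¹) * (projWeight a s * projError Q h x) + ε * normAvg Q a h s x := by
  simp only [normAvg_eq]
  set u := fun i j => projSum (empirical x) a h i (x j) / (n * s)
  set v := fun i j => projSum Q a h i (x j) / (n * s)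
  have hn0 : (0 : ℝ) ≤ (n : ℝ)⁻¹ := by positivity
  calc _ = (n : ℝ)⁻¹ * |∑ i, ∑ j, (u i j ^ 2 - v i j ^ 2)| := by
        rw [← mul_sub, abs_mul, abs_of_nonneg hn0]
        simp only [Finset.sum_sub_distrib, u, v]
    _ ≤ (n : ℝ)⁻¹ * ∑ i, ∑ j, ((1 + ε⁻¹) * (u i j - v i j) ^ 2 + ε * v i j ^ 2) := by
        gcongr
        refine (Finset.abs_sum_le_sum_abs _ _).trans (Finset.sum_le_sum fun i _ => ?_)
        exact (Finset.abs_sum_le_sum_abs _ _).trans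
          (Finset.sum_le_sum fun j _ => abs_sq_sub_sq_le hε _ _)
    _ = (1 + ε⁻¹) * ((n : ℝ)⁻¹ * ∑ i, ∑ j, (u i j - v i j) ^ 2) +
          ε * ((n : ℝ)⁻¹ * ∑ i, ∑ j, v i j ^ 2) := by
        simp only [Finset.sum_add_distrib, ← Finset.mul_sum]
        ring
    _ ≤ _ := by
        gcongr (1 + ε⁻¹) * ?_ + _
        exact mean_projSum_empirical_sub_sq_le Q a h s x

end EmpiricalProjections

namespace IsSample

variable {Ω S : Type*} [MeasurableSpace Ω] [MeasurableSpace S] {μ : Measure Ω}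
  [IsProbabilityMeasure μ] {n : ℕ} {X : Fin n → Ω → S} {Q : Measure S}

lemma theta_eq_meanKernel {m : ℕ} (hs : IsSample μ X Q) {h : (Fin m → S) → ℝ}
    (hh : Measurable h) {I : Fin m → Fin n} (hI : I ∈ indexSet m n) :
    theta μ h X I = meanKernel Q h :=
  integral_comp_of_measurePreserving (hs.measurePreserving_tuple (mem_indexSet.1 hI))
    hh.aestronglyMeasurable

lemma M1_eq_zero {m : ℕ} (hs : IsSample μ X Q) {h : (Fin m → S) → ℝ} (hh : Measurable h) :
    M1 μ h X = 0 := by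
  refine le_antisymm (Real.sSup_nonpos ?_) (Real.sSup_nonneg ?_)
  · rintro _ ⟨I, hI, J, hJ, rfl⟩
    rw [hs.theta_eq_meanKernel hh hI, hs.theta_eq_meanKernel hh hJ, sub_self, abs_zero]
  · rintro _ ⟨I, -, J, -, rfl⟩
    exact abs_nonneg _

variable {d : ℕ} {h : (Fin (d + 1) → S) → ℝ}

lemma integral_mul_eq_integral_prod {m : ℕ} (hs : IsSample μ X Q)
    {h : (Fin (d + 1) → S) → ℝ} (hh : Measurable h) {g : (Fin m → S) → ℝ} (hg : Measurable g)
    {t : Fin (d + 1) → Fin n} {s : Fin m → Fin n} (ht : Function.Injective t)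
    {p : Fin (d + 1)} {q : Fin m} (hpq : t p = s q) (hts : Set.range t ∩ Set.range s = {s q}) :
    ∫ ω, h (fun j => X (t j) ω) * g (fun j => X (s j) ω) ∂μ =
      ∫ z, h (Fin.insertNth (α := fun _ => S) p (z.1 q) z.2) * g z.1
        ∂((μ.map fun ω j => X (s j) ω).prod (Measure.pi fun _ : Fin d => Q)) := by
  have hdisj : ∀ j l, s j ≠ t (p.succAbove l) := fun j l hj => by
    have hmem : t (p.succAbove l) ∈ Set.range t ∩ Set.range s := ⟨⟨_, rfl⟩, ⟨j, hj⟩⟩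
    rw [hts, Set.mem_singleton_iff, ← hpq] at hmem
    exact Fin.succAbove_ne p l (ht hmem)
  have hS := hs.measurable_tuple s
  have hT := hs.measurable_tuple fun l => t (p.succAbove l)
  have hjoint := (indepFun_iff_map_prod_eq_prod_map_map hS.aemeasurable hT.aemeasurable).1
    (hs.indepFun_tuple hdisj)
  rw [(hs.measurePreserving_tuple (I := fun l => t (p.succAbove l))
    (ht.comp Fin.succAbove_right_injective)).map_eq] at hjoint
  have hmeas : Measurable fun z : (Fin m → S) × (Fin d → S) =>
      h (Fin.insertNth (α := fun _ => S) p (z.1 q) z.2) * g z.1 :=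
    (hh.comp ((measurable_insertNth p).comp
      (((measurable_pi_apply q).comp measurable_fst).prodMk measurable_snd))).mul
      (hg.comp measurable_fst)
  rw [← hjoint, integral_map (hS.prodMk hT).aemeasurable hmeas.aestronglyMeasurable]
  have hinsert : ∀ ω, Fin.insertNth (α := fun _ => S) p (X (s q) ω)
      (fun l => X (t (p.succAbove l)) ω) = fun j => X (t j) ω := fun ω => by
    rw [← hpq]
    exact Fin.insertNth_self_removeNth p fun j => X (t j) ω
  simp only [hinsert]

lemma M2_eq_zero (hs : IsSample μ X Q) (hh : Measurable h) : M2 μ h X = 0 := by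
  refine le_antisymm (Real.sSup_nonpos ?_) (Real.sSup_nonneg ?_)
  · rintro _ ⟨p, q, r, hr, s, -, k, hk, ⟨hrp, hrs⟩, ⟨hkp, hks⟩, rfl⟩
    have hle := (hs.measurable (k p)).comap_le
    rw [meanCondProd, meanCondProd, integral_condExp hle, integral_condExp hle,
      hs.integral_mul_eq_integral_prod hh hh (mem_indexSet.1 hr) hrp hrs,
      hs.integral_mul_eq_integral_prod hh hh (mem_indexSet.1 hk) hkp hks, sub_self, abs_zero]
  · rintro _ ⟨p, q, r, -, s, -, k, -, -, -, rfl⟩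
    exact abs_nonneg _

end IsSample

section ConvergenceInMeasure

variable {ι Ω : Type*} [MeasurableSpace Ω] {μ : Measure Ω} {l : Filter ι} {Y Z : ι → Ω → ℝ}

lemma tendstoInMeasure_of_abs_sub_le_of_integral_le [IsFiniteMeasure μ] {c : ℝ}
    (hZ : ∀ δ > 0, ∀ᶠ n in l, ∃ W : Ω → ℝ, Integrable W μ ∧ (∀ ω, |Z n ω - c| ≤ W ω) ∧
      ∫ ω, W ω ∂μ ≤ δ) : TendstoInMeasure μ Z l fun _ => c := by
  rw [tendstoInMeasure_iff_measureReal_dist]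
  intro ε hε
  rw [Metric.tendsto_nhds]
  intro η hη
  filter_upwards [hZ (ε * (η / 2)) (by positivity)] with n ⟨W, hW, hle, hint⟩
  have hW0 : 0 ≤ᵐ[μ] W := ae_of_all _ fun ω => (abs_nonneg _).trans (hle ω)
  have hmarkov : ε * μ.real {ω | ε ≤ W ω} ≤ ε * (η / 2) :=
    (mul_meas_ge_le_integral_of_nonneg hW0 hW ε).trans hint
  have hmono : μ.real {ω | ε ≤ dist (Z n ω) c} ≤ μ.real {ω | ε ≤ W ω} :=
    measureReal_mono fun ω hω => le_trans hω (hle ω)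
  rw [Real.dist_eq, sub_zero, abs_of_nonneg measureReal_nonneg]
  linarith [le_of_mul_le_mul_left hmarkov hε]

lemma tendstoInMeasure_of_integral_sub_sq_le [IsProbabilityMeasure μ] {v b : ι → ℝ} {c : ℝ}
    (hv : Tendsto v l (𝓝 c)) (hb : Tendsto b l (𝓝 0))
    (hZ : ∀ᶠ n in l, Integrable (fun ω => (Z n ω - v n) ^ 2) μ ∧
      ∫ ω, (Z n ω - v n) ^ 2 ∂μ ≤ b n) : TendstoInMeasure μ Z l fun _ => c := by
  refine tendstoInMeasure_of_abs_sub_le_of_integral_le fun δ hδ => ?_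
  have hlim : Tendsto (fun n => δ / 2 + (δ / 2)⁻¹ * b n + |v n - c|) l (𝓝 (δ / 2)) := by
    simpa using ((hb.const_mul (δ / 2)⁻¹).const_add (δ / 2)).add (hv.sub_const c).abs
  filter_upwards [hZ, hlim.eventually_le_const (half_lt_self hδ)] with n ⟨hi, hle⟩ hn
  have hint := (integrable_const (δ / 2)).add (hi.const_mul (δ / 2)⁻¹)
  refine ⟨_, hint.add (integrable_const |v n - c|), fun ω => ?_, ?_⟩
  · have hyoung : δ / 2 + (δ / 2)⁻¹ * (Z n ω - v n) ^ 2 - 2 * |Z n ω - v n| =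
        (δ / 2)⁻¹ * (|Z n ω - v n| - δ / 2) ^ 2 := by
      rw [← sq_abs (Z n ω - v n)]
      field_simp
      ring
    have hnonneg : 0 ≤ (δ / 2)⁻¹ * (|Z n ω - v n| - δ / 2) ^ 2 := by positivity
    refine (abs_sub_le _ (v n) c).trans (add_le_add_left ?_ _)
    simp only [Pi.add_apply]
    linarith [abs_nonneg (Z n ω - v n)]
  · rw [integral_add' hint (integrable_const _),
      integral_add' (integrable_const _) (hi.const_mul _), integral_const_mul]
    simp only [integral_const, probReal_univ, one_smul]
    refine le_trans ?_ hn
    gcongr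

lemma tendstoInMeasure_add {f g : Ω → ℝ} (hY : TendstoInMeasure μ Y l f)
    (hZ : TendstoInMeasure μ Z l g) :
    TendstoInMeasure μ (fun n ω => Y n ω + Z n ω) l fun ω => f ω + g ω := by
  rw [tendstoInMeasure_iff_dist] at *
  intro ε hε
  refine tendsto_of_tendsto_of_tendsto_of_le_of_le tendsto_const_nhds
    (by simpa using (hY (ε / 2) (half_pos hε)).add (hZ (ε / 2) (half_pos hε)))
    (fun _ => zero_le) fun n => (measure_mono fun ω hω => ?_).trans (measure_union_le _ _)
  by_contra! hlt
  simp only [Set.mem_union, Set.mem_ofPred_eq, not_or, not_le] at hω hlt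
  linarith [dist_add_add_le (Y n ω) (Z n ω) (f ω) (g ω)]

lemma tendstoInMeasure_abs_sub {v : ι → ℝ} {c : ℝ}
    (hZ : TendstoInMeasure μ Z l fun _ => c) (hv : ∀ᶠ n in l, v n = c) :
    TendstoInMeasure μ (fun n ω => |Z n ω - v n|) l fun _ => 0 := by
  rw [tendstoInMeasure_iff_dist] at *
  refine fun ε hε => (hZ ε hε).congr' ?_
  filter_upwards [hv] with n hn
  simp only [hn, Real.dist_eq, sub_zero, abs_abs]

end ConvergenceInMeasure

section WeightLimits

lemma tendsto_zero_of_le_const_mul {ι : Type*} {l : Filter ι} {f g : ι → ℝ}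
    (hg : Tendsto g l (𝓝 0)) (c : ℝ) (h0 : ∀ᶠ n in l, 0 ≤ f n)
    (hle : ∀ᶠ n in l, f n ≤ c * g n) : Tendsto f l (𝓝 0) :=
  squeeze_zero' h0 hle (by simpa using hg.const_mul c)

lemma sum_pow_le_sum_pow_of_sum_pow_le_one {ι : Type*} {s : Finset ι} {x : ι → ℝ} {j k : ℕ}
    (hj : j ≠ 0) (hjk : j ≤ k) (hx : ∀ i ∈ s, 0 ≤ x i) (hsum : ∑ i ∈ s, x i ^ j ≤ 1) :
    ∑ i ∈ s, x i ^ k ≤ ∑ i ∈ s, x i ^ j := by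
  refine Finset.sum_le_sum fun i hi => pow_le_pow_of_le_one (hx i hi) ?_ hjk
  refine (pow_le_one_iff_of_nonneg (hx i hi) hj).1 (le_trans ?_ hsum)
  exact Finset.single_le_sum (f := fun i => x i ^ j) (fun i hi => pow_nonneg (hx i hi) j) hi

lemma zpow_neg_two (x : ℝ) : x ^ (-2 : ℤ) = (x ^ 2)⁻¹ := by
  rw [zpow_neg]
  norm_cast

variable {d n : ℕ}

lemma remainderFactor_mul_le (hn : d + 1 ≤ n) (a : (Fin (d + 1) → Fin n) → ℝ) {s v c e : ℝ}
    (hv : 0 < v) (hvs : v ≤ s ^ 2) (hc : 0 ≤ c) (hce : c ≤ e) :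
    remainderFactor a s * c ≤ (((d + 1 : ℕ) : ℝ) ^ (d + 1 + 2)) ^ 2 * (2 * d + 4) ^ 2 *
      ((n : ℝ) ^ (-2 : ℤ) * v ^ (-1 : ℤ) * avgWeight 2 2 a * e) := by
  have hw := sharedWeight_two_two_le (by lia) hn a
  have hA := avgWeight_nonneg 2 2 a
  have hw0 := sharedWeight_nonneg 2 2 a
  have hinv : (s ^ 2)⁻¹ ≤ v⁻¹ := inv_anti₀ hv hvs
  rw [remainderFactor, zpow_neg_two, zpow_neg_one, inv_pow]
  calc _ ≤ v⁻¹ * ((((d + 1 : ℕ) : ℝ) ^ (d + 1 + 2)) ^ 2 * (((n : ℝ) ^ 2)⁻¹ * avgWeight 2 2 a) *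
        (2 * d + 4) ^ 2) * e := by gcongr
    _ = _ := by ring

lemma remainderFactor_mul_inv_le (hn : d + 1 ≤ n) (a : (Fin (d + 1) → Fin n) → ℝ) (s : ℝ) :
    remainderFactor a s * (n : ℝ)⁻¹ ≤ (((d + 1 : ℕ) : ℝ) ^ (d + 1 + 1)) ^ 2 * (2 * d + 4) ^ 2 *
      ((n : ℝ) ^ (-2 : ℤ) * s ^ (-2 : ℤ) * avgWeight 2 1 a) := by
  have hw := sharedWeight_two_two_le_avgWeight_two_one (by lia) hn a
  rw [remainderFactor, zpow_neg_two, zpow_neg_two, inv_pow]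
  calc _ ≤ (s ^ 2)⁻¹ * ((((d + 1 : ℕ) : ℝ) ^ (d + 1 + 1)) ^ 2 * ((n : ℝ)⁻¹ * avgWeight 2 1 a) *
        (2 * d + 4) ^ 2) * (n : ℝ)⁻¹ := by gcongr
    _ = _ := by ring

lemma projWeight_nonneg (a : (Fin (d + 1) → Fin n) → ℝ) (s : ℝ) : 0 ≤ projWeight a s := by
  unfold projWeight
  positivity

lemma projWeight_mul_inv_le (hn : d + 1 ≤ n) (a : (Fin (d + 1) → Fin n) → ℝ) (s : ℝ) :
    projWeight a s * (n : ℝ)⁻¹ ≤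
      (d + 1) * ((d + 1 : ℕ) * (((d + 1 : ℕ) : ℝ) ^ (d + 1 + 1)) ^ 2) *
        ((n : ℝ) ^ (-2 : ℤ) * s ^ (-2 : ℤ) * avgWeight 2 1 a) := by
  have hn0 : (n : ℝ) ≠ 0 := Nat.cast_ne_zero.2 (by lia)
  have hw := sum_absWeight_pow_le two_pos hn a
  rw [projWeight, zpow_neg_two, zpow_neg_two]
  calc _ ≤ ((n * s) ^ 2)⁻¹ * ((d + 1) * ((d + 1 : ℕ) * (((d + 1 : ℕ) : ℝ) ^ (d + 1 + 1)) ^ 2 *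
        (n * avgWeight 2 1 a))) * (n : ℝ)⁻¹ := by gcongr
    _ = _ := by
        rw [mul_pow, mul_inv]
        field_simp

lemma lyapunovSum_three_le (hn : d + 1 ≤ n) (a : (Fin (d + 1) → Fin n) → ℝ) {s v M : ℝ}
    (hs : 0 ≤ s) (hv : 0 < v) (hvs : v ≤ s ^ 2) (hM : 0 ≤ M) :
    lyapunovSum 3 a M s ≤ (d + 1 : ℕ) * (((d + 1 : ℕ) : ℝ) ^ (d + 1 + 1)) ^ 3 *
      ((n : ℝ) ^ (-2 : ℤ) * v ^ (-(3 / 2) : ℝ) * avgWeight 3 1 a * M ^ (3 / 4 : ℝ)) := by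
  have hn0 : (n : ℝ) ≠ 0 := Nat.cast_ne_zero.2 (by lia)
  have hw := sum_absWeight_pow_le three_pos hn a
  have hA := avgWeight_nonneg 3 1 a
  have hM3 : (M ^ (1 / 4 : ℝ)) ^ 3 = M ^ (3 / 4 : ℝ) := by
    rw [← Real.rpow_natCast, ← Real.rpow_mul hM]
    norm_num
  have hs3 : (s ^ 2) ^ (3 / 2 : ℝ) = s ^ 3 := by
    rw [← Real.rpow_natCast, ← Real.rpow_mul hs, ← Real.rpow_natCast]
    norm_num
  have hvs3 : (s ^ 3)⁻¹ ≤ v ^ (-(3 / 2) : ℝ) := by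
    rw [Real.rpow_neg hv.le, ← hs3]
    gcongr
  have := Real.rpow_nonneg hM (3 / 4)
  calc lyapunovSum 3 a M s
      = (∑ i, absWeight a i ^ 3) * (((n : ℝ) ^ 3)⁻¹ * (s ^ 3)⁻¹ * M ^ (3 / 4 : ℝ)) := by
        rw [lyapunovSum, Finset.sum_mul]
        refine Finset.sum_congr rfl fun i _ => ?_
        rw [div_pow, mul_pow, mul_pow, hM3]
        ring
    _ ≤ (d + 1 : ℕ) * (((d + 1 : ℕ) : ℝ) ^ (d + 1 + 1)) ^ 3 * (n * avgWeight 3 1 a) *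
        (((n : ℝ) ^ 3)⁻¹ * v ^ (-(3 / 2) : ℝ) * M ^ (3 / 4 : ℝ)) := by gcongr
    _ = _ := by
        rw [zpow_neg_two]
        field_simp

variable {a : (n : ℕ) → (Fin (d + 1) → Fin n) → ℝ} {s v M : ℕ → ℝ}

lemma tendsto_remainderFactor_mul {c e : ℕ → ℝ} (hv : ∀ᶠ n in atTop, 0 < v n)
    (hvs : ∀ᶠ n in atTop, v n ≤ s n ^ 2) (hc : ∀ n, 0 ≤ c n) (hce : ∀ᶠ n in atTop, c n ≤ e n)
    (h : Tendsto (fun n : ℕ => (n : ℝ) ^ (-2 : ℤ) * v n ^ (-1 : ℤ) * avgWeight 2 2 (a n) * e n)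
      atTop (𝓝 0)) :
    Tendsto (fun n => remainderFactor (a n) (s n) * c n) atTop (𝓝 0) :=
  tendsto_zero_of_le_const_mul h _
    (.of_forall fun n => mul_nonneg (remainderFactor_nonneg _ _) (hc n))
    (((eventually_ge_atTop (d + 1)).and (hv.and (hvs.and hce))).mono
      fun n ⟨hn, hv, hvs, hce⟩ => remainderFactor_mul_le hn (a n) hv hvs (hc n) hce)

lemma tendsto_remainderFactor_mul_inv
    (hA : Tendsto (fun n : ℕ => (n : ℝ) ^ (-2 : ℤ) * s n ^ (-2 : ℤ) * avgWeight 2 1 (a n))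
      atTop (𝓝 0)) :
    Tendsto (fun n : ℕ => remainderFactor (a n) (s n) * (n : ℝ)⁻¹) atTop (𝓝 0) :=
  tendsto_zero_of_le_const_mul hA _
    (.of_forall fun n => mul_nonneg (remainderFactor_nonneg _ _) (by positivity))
    ((eventually_ge_atTop (d + 1)).mono fun _ hn => remainderFactor_mul_inv_le hn _ _)

lemma tendsto_projWeight_mul_inv
    (hA : Tendsto (fun n : ℕ => (n : ℝ) ^ (-2 : ℤ) * s n ^ (-2 : ℤ) * avgWeight 2 1 (a n))
      atTop (𝓝 0)) :
    Tendsto (fun n : ℕ => projWeight (a n) (s n) * (n : ℝ)⁻¹) atTop (𝓝 0) :=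
  tendsto_zero_of_le_const_mul hA _
    (.of_forall fun n => mul_nonneg (projWeight_nonneg _ _) (by positivity))
    ((eventually_ge_atTop (d + 1)).mono fun _ hn => projWeight_mul_inv_le hn _ _)

lemma tendsto_lyapunovSum_four (hs : ∀ n, 0 ≤ s n) (hv : ∀ᶠ n in atTop, 0 < v n)
    (hvs : ∀ᶠ n in atTop, v n ≤ s n ^ 2) (hM : ∀ n, 0 ≤ M n)
    (h : Tendsto (fun n : ℕ => (n : ℝ) ^ (-2 : ℤ) * v n ^ (-(3 / 2) : ℝ) *
      avgWeight 3 1 (a n) * M n ^ (3 / 4 : ℝ)) atTop (𝓝 0)) :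
    Tendsto (fun n => lyapunovSum 4 (a n) (M n) (s n)) atTop (𝓝 0) := by
  have hterm : ∀ n i, 0 ≤ absWeight (a n) i * M n ^ (1 / 4 : ℝ) / (n * s n) := fun n i =>
    div_nonneg (mul_nonneg (absWeight_nonneg _ i) (Real.rpow_nonneg (hM n) _))
      (mul_nonneg n.cast_nonneg (hs n))
  have hthree : Tendsto (fun n => lyapunovSum 3 (a n) (M n) (s n)) atTop (𝓝 0) :=
    tendsto_zero_of_le_const_mul h _
      (.of_forall fun n => Finset.sum_nonneg fun i _ => pow_nonneg (hterm n i) 3)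
      (((eventually_ge_atTop (d + 1)).and (hv.and hvs)).mono
        fun n ⟨hn, hv, hvs⟩ => lyapunovSum_three_le hn (a n) (hs n) hv hvs (hM n))
  refine squeeze_zero' (.of_forall fun n => Finset.sum_nonneg fun i _ => pow_nonneg (hterm n i) 4)
    ?_ hthree
  filter_upwards [hthree.eventually_le_const zero_lt_one] with n hn
  exact sum_pow_le_sum_pow_of_sum_pow_le_one three_ne_zero (by norm_num) (fun i _ => hterm n i) hn

end WeightLimits

section SampleMoments

variable {Ω S : Type*} [MeasurableSpace Ω] {μ : Measure Ω} {n : ℕ}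

lemma sigma_sq {m : ℕ} (a : (Fin m → Fin n) → ℝ) (h : (Fin m → S) → ℝ) (X : Fin n → Ω → S) :
    sigma μ a h X ^ 2 = variance (U a h X) μ :=
  Real.sq_sqrt (variance_nonneg _ _)

lemma variance_inv_sigma_mul_U {m : ℕ} {a : (Fin m → Fin n) → ℝ} {h : (Fin m → S) → ℝ}
    {X : Fin n → Ω → S} (hσ : sigma μ a h X ≠ 0) :
    variance (fun ω => (sigma μ a h X)⁻¹ * U a h X ω) μ = 1 := by
  rw [variance_const_mul, ← sigma_sq, inv_pow, inv_mul_cancel₀ (pow_ne_zero 2 hσ)]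

variable [MeasurableSpace S] [IsProbabilityMeasure μ]

lemma exists_isSample [Nonempty S] {X : Fin n → Ω → S} (hX : ∀ i, Measurable (X i))
    (hindep : iIndepFun X μ) (hident : ∀ i j, IdentDistrib (X i) (X j) μ μ) :
    ∃ Q : Measure S, IsProbabilityMeasure Q ∧ IsSample μ X Q := by
  rcases n with - | n
  · exact ⟨Measure.dirac (Classical.arbitrary S), inferInstance, hX, hindep, fun i => i.elim0⟩
  · exact ⟨μ.map (X 0), Measure.isProbabilityMeasure_map (hX 0).aemeasurable, hX, hindep,
      fun i => (hident i 0).map_eq⟩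

variable {d : ℕ} {X : Fin n → Ω → S} {Q : Measure S}

lemma IsSample.lintegral_pi (hs : IsSample μ X Q) {I : Fin (d + 1) → Fin n}
    (hI : Function.Injective I) {g : (Fin (d + 1) → S) → ℝ≥0∞} (hg : Measurable g) :
    ∫⁻ z, g z ∂(Measure.pi fun _ => Q) = ∫⁻ ω, g (fun k => X (I k) ω) ∂μ :=
  ((hs.measurePreserving_tuple hI).lintegral_comp hg).symm

variable {h : (Fin (d + 1) → S) → ℝ}

lemma IsSample.V_le_sigma_sq [IsProbabilityMeasure Q] (hs : IsSample μ X Q) (hh : Measurable h)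
    (hh2 : MemLp h 2 (Measure.pi fun _ => Q)) (a : (Fin (d + 1) → Fin n) → ℝ) :
    V μ a h X ≤ sigma μ a h X ^ 2 :=
  (hs.V_le_variance_U hh hh2 a).trans_eq (sigma_sq a h X).symm

lemma IsSample.memLp_four_and_integral_le (hs : IsSample μ X Q) (hh : Measurable h)
    (hn : d + 1 ≤ n) {M : ℝ} (hM : 0 ≤ M)
    (hmoment : ∀ I ∈ indexSet (d + 1) n,
      ∫⁻ ω, ENNReal.ofReal (h (fun k => X (I k) ω) ^ 4) ∂μ ≤ ENNReal.ofReal M) :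
    MemLp h 4 (Measure.pi fun _ => Q) ∧ ∫ z, h z ^ 4 ∂(Measure.pi fun _ => Q) ≤ M := by
  have hI := Fin.castLE_injective hn
  have hle := (hs.lintegral_pi hI (hh.pow_const 4).ennreal_ofReal).trans_le
    (hmoment _ (mem_indexSet.2 hI))
  exact ⟨mod_cast memLp_of_lintegral_ofReal_pow_ne_top hh.aestronglyMeasurable (by decide)
    four_ne_zero (ne_top_of_le_ne_top ENNReal.ofReal_ne_top hle),
    integral_le_of_lintegral_ofReal_le (hh.pow_const 4).aestronglyMeasurable
      (fun _ => by positivity) hM hle⟩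

lemma IsSample.secondMomentBound (hs : IsSample μ X Q) (hh : Measurable h) (hn : d + 1 ≤ n)
    {B : ℝ} (hB : 0 ≤ B)
    (hle : ∀ I : Fin (d + 1) → Fin n,
      ∫⁻ ω, ENNReal.ofReal (h (fun k => X (I k) ω) ^ 2) ∂μ ≤ ENNReal.ofReal B) :
    SecondMomentBound μ X Q h B := by
  have hI := Fin.castLE_injective hn
  have hpi := (hs.lintegral_pi hI (hh.pow_const 2).ennreal_ofReal).trans_le (hle _)
  have hmeas : ∀ I : Fin (d + 1) → Fin n, Measurable fun ω => h fun k => X (I k) ω :=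
    fun I => hh.comp (hs.measurable_tuple I)
  exact {
    memLp := fun I => mod_cast memLp_of_lintegral_ofReal_pow_ne_top (hmeas I).aestronglyMeasurable
      even_two two_ne_zero (ne_top_of_le_ne_top ENNReal.ofReal_ne_top (hle I))
    le := fun I => integral_le_of_lintegral_ofReal_le
      ((hmeas I).pow_const 2).aestronglyMeasurable (fun _ => sq_nonneg _) hB (hle I)
    memLp_pi := mod_cast memLp_of_lintegral_ofReal_pow_ne_top hh.aestronglyMeasurable
      even_two two_ne_zero (ne_top_of_le_ne_top ENNReal.ofReal_ne_top hpi)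
    pi_le := integral_le_of_lintegral_ofReal_le (hh.pow_const 2).aestronglyMeasurable
      (fun _ => sq_nonneg _) hB hpi }

end SampleMoments

section TriangularArrays

variable {Ω S : Type*} [MeasurableSpace Ω] [MeasurableSpace S] {μ : Measure Ω}
  [IsProbabilityMeasure μ] {d : ℕ} {X : (n : ℕ) → Fin n → Ω → S} {Q : ℕ → Measure S}
  {a : (n : ℕ) → (Fin (d + 1) → Fin n) → ℝ} {h : ℕ → (Fin (d + 1) → S) → ℝ}

lemma exists_forall_isSample (hX : ∀ n i, Measurable (X n i)) (hindep : ∀ n, iIndepFun (X n) μ)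
    (hident : ∀ n i j, IdentDistrib (X n i) (X n j) μ μ) :
    ∃ Q : ℕ → Measure S, (∀ n, IsProbabilityMeasure (Q n)) ∧ ∀ n, IsSample μ (X n) (Q n) := by
  have hΩ := μ.nonempty_of_neZero
  have : Nonempty S := hΩ.map (X 1 0)
  choose Q hQ hs using fun n => exists_isSample (hX n) (hindep n) (hident n)
  exact ⟨Q, hQ, hs⟩

variable {s M : ℕ → ℝ} {B : ℝ}

lemma eventually_memLp_four_and_integral_le (hs : ∀ n, IsSample μ (X n) (Q n))
    (hh : ∀ n, Measurable (h n)) (hM : ∀ n, 0 ≤ M n)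
    (hmoment : ∀ n, ∀ I ∈ indexSet (d + 1) n,
      ∫⁻ ω, ENNReal.ofReal (h n (fun k => X n (I k) ω) ^ 4) ∂μ ≤ ENNReal.ofReal (M n)) :
    ∀ᶠ n in atTop, MemLp (h n) 4 (Measure.pi fun _ => Q n) ∧
      ∫ z, h n z ^ 4 ∂(Measure.pi fun _ => Q n) ≤ M n :=
  (eventually_ge_atTop (d + 1)).mono fun n hn =>
    (hs n).memLp_four_and_integral_le (hh n) hn (hM n) (hmoment n)

lemma exists_eventually_secondMomentBound (hs : ∀ n, IsSample μ (X n) (Q n))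
    (hh : ∀ n, Measurable (h n))
    (hmises : limsup (fun n : ℕ => ⨆ I : Fin (d + 1) → Fin n,
      ∫⁻ ω, ENNReal.ofReal (h n (fun k => X n (I k) ω) ^ 2) ∂μ) atTop < ⊤) :
    ∃ B : ℝ, ∀ᶠ n in atTop, SecondMomentBound μ (X n) (Q n) (h n) B := by
  obtain ⟨b, hlt, hb⟩ := exists_between hmises
  refine ⟨b.toReal, ?_⟩
  filter_upwards [eventually_lt_of_limsup_lt hlt, eventually_ge_atTop (d + 1)] with n hle hn
  refine (hs n).secondMomentBound (hh n) hn ENNReal.toReal_nonneg fun I => ?_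
  rw [ENNReal.ofReal_toReal hb.ne]
  exact (le_iSup (fun I : Fin (d + 1) → Fin n =>
    ∫⁻ ω, ENNReal.ofReal (h n (fun k => X n (I k) ω) ^ 2) ∂μ) I).trans hle.le

lemma tendsto_avgWeight_mul_heterogeneity (hs : ∀ n, IsSample μ (X n) (Q n))
    (hh : ∀ n, Measurable (h n))
    (hA : Tendsto (fun n : ℕ => (n : ℝ) ^ (-2 : ℤ) * s n ^ (-2 : ℤ) * avgWeight 2 1 (a n))
      atTop (𝓝 0)) :
    Tendsto (fun n : ℕ => (n : ℝ)⁻¹ * s n ^ (-2 : ℤ) * avgWeight 2 1 (a n) *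
      (M1 μ (h n) (X n) ^ 2 + M2 μ (h n) (X n) + (n : ℝ)⁻¹)) atTop (𝓝 0) := by
  refine hA.congr fun n => ?_
  rw [(hs n).M1_eq_zero (hh n), (hs n).M2_eq_zero (hh n), zpow_neg_two (n : ℝ), sq, mul_inv]
  ring

lemma tendstoInMeasure_bootstrapVar_sub_normAvg (hs : ∀ n, IsSample μ (X n) (Q n))
    (hh : ∀ n, Measurable (h n)) (hB : ∀ᶠ n in atTop, SecondMomentBound μ (X n) (Q n) (h n) B)
    (hρ : Tendsto (fun n => remainderFactor (a n) (s n) *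
      ∫ z, h n z ^ 2 ∂(Measure.pi fun _ => Q n)) atTop (𝓝 0))
    (hρn : Tendsto (fun n : ℕ => remainderFactor (a n) (s n) * (n : ℝ)⁻¹) atTop (𝓝 0)) :
    TendstoInMeasure μ (fun n ω =>
      bootstrapVar (fun y => (s n)⁻¹ * uStat (a n) (h n) y) (fun i => X n i ω) -
        normAvg (empirical fun i => X n i ω) (a n) (h n) (s n) fun i => X n i ω)
      atTop fun _ => 0 := by
  refine tendstoInMeasure_of_abs_sub_le_of_integral_le fun δ hδ => ?_
  have hlim : Tendsto (fun n : ℕ => remainderFactor (a n) (s n) *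
      ∫ z, h n z ^ 2 ∂(Measure.pi fun _ => Q n) +
        (d + 1) ^ 2 * B * (remainderFactor (a n) (s n) * (n : ℝ)⁻¹)) atTop (𝓝 0) := by
    simpa using hρ.add (hρn.const_mul ((d + 1) ^ 2 * B))
  filter_upwards [hB, hlim.eventually_le_const hδ, eventually_ge_atTop 1] with n hB hle hn
  have : NeZero n := ⟨Nat.one_le_iff_ne_zero.1 hn⟩
  refine ⟨_, (hB.integrable_integral_empirical_sq (hh n)).const_mul
    (remainderFactor (a n) (s n)), fun ω => ?_, ?_⟩
  · rw [sub_zero]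
    exact abs_bootstrapVar_sub_normAvg_le (hh n) (s n) (a n) _
  · rw [integral_const_mul]
    refine (mul_le_mul_of_nonneg_left (hB.integral_integral_empirical_sq_le (hs n) (hh n))
      (remainderFactor_nonneg _ _)).trans (le_trans (le_of_eq ?_) hle)
    ring

variable [∀ n, IsProbabilityMeasure (Q n)]

lemma tendsto_V_div_sigma_sq (hs : ∀ n, IsSample μ (X n) (Q n)) (hh : ∀ n, Measurable (h n))
    (hh2 : ∀ᶠ n in atTop, MemLp (h n) 2 (Measure.pi fun _ => Q n))
    (hσ : ∀ᶠ n in atTop, sigma μ (a n) (h n) (X n) ≠ 0)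
    (hρ : Tendsto (fun n => remainderFactor (a n) (sigma μ (a n) (h n) (X n)) *
      ∫ z, h n z ^ 2 ∂(Measure.pi fun _ => Q n)) atTop (𝓝 0)) :
    Tendsto (fun n => V μ (a n) (h n) (X n) / sigma μ (a n) (h n) (X n) ^ 2) atTop (𝓝 1) := by
  refine tendsto_iff_dist_tendsto_zero.2 (squeeze_zero' (.of_forall fun _ => dist_nonneg) ?_ hρ)
  filter_upwards [hh2, hσ] with n hh2 hσ
  have hle := (hs n).abs_variance_U_sub_V_le (hh n) hh2 (a n) (sigma μ (a n) (h n) (X n))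
  rwa [← sigma_sq, inv_pow, inv_mul_cancel₀ (pow_ne_zero 2 hσ), ← Real.dist_eq, dist_comm] at hle

lemma tendstoInMeasure_normAvg {c : ℝ} (hs : ∀ n, IsSample μ (X n) (Q n))
    (hh : ∀ n, Measurable (h n)) (hM : ∀ n, 0 ≤ M n)
    (h4 : ∀ᶠ n in atTop, MemLp (h n) 4 (Measure.pi fun _ => Q n) ∧
      ∫ z, h n z ^ 4 ∂(Measure.pi fun _ => Q n) ≤ M n)
    (hv : Tendsto (fun n => V μ (a n) (h n) (X n) / s n ^ 2) atTop (𝓝 c))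
    (hL : Tendsto (fun n => lyapunovSum 4 (a n) (M n) (s n)) atTop (𝓝 0)) :
    TendstoInMeasure μ (fun n ω => normAvg (Q n) (a n) (h n) (s n) fun i => X n i ω) atTop
      fun _ => c := by
  refine tendstoInMeasure_of_integral_sub_sq_le hv
    (by simpa using hL.const_mul (16 * ((d : ℝ) + 1) ^ 4)) ?_
  filter_upwards [h4, eventually_ge_atTop 1] with n ⟨hh4, hle⟩ hn
  have : NeZero n := ⟨Nat.one_le_iff_ne_zero.1 hn⟩
  exact ⟨(hs n).integrable_normAvg_sub_sq (hh n) hh4 _ _ _,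
    (hs n).integral_normAvg_sub_sq_le (hh n) hh4 (hM n) hle _ _⟩

lemma tendstoInMeasure_sum_sum_projSum_sq {c : ℝ} (hs : ∀ n, IsSample μ (X n) (Q n))
    (hh : ∀ n, Measurable (h n)) (hh2 : ∀ᶠ n in atTop, MemLp (h n) 2 (Measure.pi fun _ => Q n))
    (hv : Tendsto (fun n => V μ (a n) (h n) (X n) / s n ^ 2) atTop (𝓝 c)) :
    TendstoInMeasure μ (fun (n : ℕ) ω => ((n : ℝ) ^ 2)⁻¹ * ∑ i, (∑ j,
      projSum (Q n) (a n) (h n) i (X n j ω) / (n * s n)) ^ 2) atTop fun _ => 0 := by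
  have hlim : Tendsto (fun n : ℕ => (n : ℝ)⁻¹ * (V μ (a n) (h n) (X n) / s n ^ 2)) atTop
      (𝓝 0) := by
    simpa using tendsto_inv_atTop_nhds_zero_nat.mul hv
  refine tendstoInMeasure_of_abs_sub_le_of_integral_le fun δ hδ => ?_
  filter_upwards [hh2, hlim.eventually_le_const hδ, eventually_ne_atTop 0] with n hh2 hle hn
  refine ⟨_, (integrable_finsetSum Finset.univ fun i _ =>
    ((hs n).memLp_sum_projSum_div (hh n) hh2 (a n) (n * s n) i).integrable_sq).const_mul
      ((n : ℝ) ^ 2)⁻¹, fun ω => ?_, ?_⟩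
  · rw [sub_zero, abs_of_nonneg (by positivity)]
  · rw [integral_const_mul, (hs n).integral_sum_sum_projSum_sq (hh n) hh2]
    refine le_trans (le_of_eq ?_) hle
    field_simp

lemma tendstoInMeasure_normAvg_empirical_sub (hs : ∀ n, IsSample μ (X n) (Q n))
    (hh : ∀ n, Measurable (h n)) (hB : ∀ᶠ n in atTop, SecondMomentBound μ (X n) (Q n) (h n) B)
    (hv : Tendsto (fun n => V μ (a n) (h n) (X n) / s n ^ 2) atTop (𝓝 1))
    (hproj : Tendsto (fun n : ℕ => projWeight (a n) (s n) * (n : ℝ)⁻¹) atTop (𝓝 0)) :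
    TendstoInMeasure μ (fun n ω =>
      normAvg (empirical fun i => X n i ω) (a n) (h n) (s n) (fun i => X n i ω) -
        normAvg (Q n) (a n) (h n) (s n) fun i => X n i ω) atTop fun _ => 0 := by
  refine tendstoInMeasure_of_abs_sub_le_of_integral_le fun δ hδ => ?_
  have hδ2 := half_pos hδ
  have hlim : Tendsto (fun n : ℕ => (1 + (δ / 2)⁻¹) * ((d + 1) * (8 * d ^ 2 + 4 * d + 4) * B) *
      (projWeight (a n) (s n) * (n : ℝ)⁻¹) + δ / 2 * (V μ (a n) (h n) (X n) / s n ^ 2))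
      atTop (𝓝 (δ / 2)) := by
    simpa using (hproj.const_mul _).add (hv.const_mul (δ / 2))
  filter_upwards [hB, hlim.eventually_le_const (half_lt_self hδ), eventually_ge_atTop 1]
    with n hB hle hn
  have : NeZero n := ⟨Nat.one_le_iff_ne_zero.1 hn⟩
  have herr := ((hB.integrable_projError (hs n) (hh n)).const_mul
    (projWeight (a n) (s n))).const_mul (1 + (δ / 2)⁻¹)
  have havg := ((hs n).integrable_normAvg (hh n) hB.memLp_pi (a n) (s n)).const_mul (δ / 2)
  refine ⟨_, herr.add havg, fun ω => ?_, ?_⟩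
  · rw [sub_zero]
    exact abs_normAvg_empirical_sub_le (Q n) (a n) (h n) (s n) _ hδ2
  · rw [integral_add' herr havg, integral_const_mul, integral_const_mul, integral_const_mul,
      (hs n).integral_normAvg (hh n) hB.memLp_pi]
    refine le_trans ?_ hle
    have hw := projWeight_nonneg (a n) (s n)
    calc _ ≤ (1 + (δ / 2)⁻¹) * (projWeight (a n) (s n) *
          ((d + 1) * (8 * d ^ 2 + 4 * d + 4) * B * (n : ℝ)⁻¹)) +
          δ / 2 * (V μ (a n) (h n) (X n) / s n ^ 2) := by
          gcongr
          exact hB.integral_projError_le (hs n) (hh n)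
      _ = _ := by ring

lemma tendstoInMeasure_bootstrapVar (hs : ∀ n, IsSample μ (X n) (Q n))
    (hh : ∀ n, Measurable (h n)) (hB : ∀ᶠ n in atTop, SecondMomentBound μ (X n) (Q n) (h n) B)
    (hρ : Tendsto (fun n => remainderFactor (a n) (s n) *
      ∫ z, h n z ^ 2 ∂(Measure.pi fun _ => Q n)) atTop (𝓝 0))
    (hv : Tendsto (fun n => V μ (a n) (h n) (X n) / s n ^ 2) atTop (𝓝 1))
    (hA : Tendsto (fun n : ℕ => (n : ℝ) ^ (-2 : ℤ) * s n ^ (-2 : ℤ) * avgWeight 2 1 (a n))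
      atTop (𝓝 0))
    (havg : TendstoInMeasure μ (fun n ω => normAvg (Q n) (a n) (h n) (s n) fun i => X n i ω)
      atTop fun _ => 1) :
    TendstoInMeasure μ (fun n ω =>
      bootstrapVar (fun y => (s n)⁻¹ * uStat (a n) (h n) y) fun i => X n i ω) atTop
      fun _ => 1 := by
  have hboot := tendstoInMeasure_bootstrapVar_sub_normAvg hs hh hB hρ
    (tendsto_remainderFactor_mul_inv hA)
  have hemp := tendstoInMeasure_normAvg_empirical_sub hs hh hB hv (tendsto_projWeight_mul_inv hA)
  simpa only [sub_add_sub_cancel, sub_add_cancel, zero_add] using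
    tendstoInMeasure_add (tendstoInMeasure_add hboot hemp) havg

end TriangularArrays

end WeightedU

theorem mainTheorem4 {Ω S : Type*} [MeasurableSpace Ω] [MeasurableSpace S]
    (μ : Measure Ω) [IsProbabilityMeasure μ]
    -- the degree is `m = d + 1`
    (d : ℕ)
    -- triangular array of data, weights and kernels
    (X : (n : ℕ) → Fin n → Ω → S)
    (a : (n : ℕ) → (Fin (d + 1) → Fin n) → ℝ)
    (h : ℕ → (Fin (d + 1) → S) → ℝ)
    (hX : ∀ n i, Measurable (X n i))
    (hh : ∀ n, Measurable (h n))
    -- for each `n`, the data are i.i.d.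
    (hindep : ∀ n, iIndepFun (X n) μ)
    (hident : ∀ n i j, IdentDistrib (X n i) (X n j) μ μ)
    -- fourth moments
    (M : ℕ → ℝ) (hM : ∀ n, 0 < M n)
    (hmoment : ∀ n, ∀ I ∈ WeightedU.indexSet (d + 1) n,
      ∫⁻ ω, ENNReal.ofReal (h n (fun k => X n (I k) ω) ^ 4) ∂μ ≤ ENNReal.ofReal (M n))
    -- the main term is nondegenerate
    (hV : ∀ᶠ n in atTop, 0 < WeightedU.V μ (a n) (h n) (X n))
    (hclt1 : Tendsto (fun n : ℕ => (n : ℝ) ^ (-2 : ℤ) *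
        WeightedU.V μ (a n) (h n) (X n) ^ (-1 : ℤ) *
        WeightedU.avgWeight 2 2 (a n) * M n ^ (1 / 2 : ℝ)) atTop (𝓝 0))
    (hclt2 : Tendsto (fun n : ℕ => (n : ℝ) ^ (-2 : ℤ) *
        WeightedU.V μ (a n) (h n) (X n) ^ (-(3 / 2) : ℝ) *
        WeightedU.avgWeight 3 1 (a n) * M n ^ (3 / 4 : ℝ)) atTop (𝓝 0))
    -- bounded second moment of von Mises type
    (hmises : limsup (fun n : ℕ => ⨆ I : Fin (d + 1) → Fin n,
        ∫⁻ ω, ENNReal.ofReal (h n (fun k => X n (I k) ω) ^ 2) ∂μ) atTop < ⊤)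
    (hA : Tendsto (fun n : ℕ => (n : ℝ) ^ (-2 : ℤ) *
        WeightedU.sigma μ (a n) (h n) (X n) ^ (-2 : ℤ) *
        WeightedU.avgWeight 2 1 (a n)) atTop (𝓝 0)) :
    -- the three heterogeneity conditions
    TendstoInMeasure μ (fun (n : ℕ) ω => (n : ℝ)⁻¹ * ∑ i : Fin n, ∑ j : Fin n,
        (WeightedU.h1 μ (a n) (h n) (X n) i (X n j ω) /
          (n * WeightedU.sigma μ (a n) (h n) (X n))) ^ 2) atTop (fun _ => (1 : ℝ)) ∧
    TendstoInMeasure μ (fun (n : ℕ) ω => ((n : ℝ) ^ 2)⁻¹ * ∑ i : Fin n, (∑ j : Fin n,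
        WeightedU.h1 μ (a n) (h n) (X n) i (X n j ω) /
          (n * WeightedU.sigma μ (a n) (h n) (X n))) ^ 2) atTop (fun _ => (0 : ℝ)) ∧
    Tendsto (fun n : ℕ => (n : ℝ)⁻¹ * WeightedU.sigma μ (a n) (h n) (X n) ^ (-2 : ℤ) *
        WeightedU.avgWeight 2 1 (a n) *
        (WeightedU.M1 μ (h n) (X n) ^ 2 + WeightedU.M2 μ (h n) (X n) + (n : ℝ)⁻¹))
      atTop (𝓝 0) ∧
    -- consistency of the bootstrap variance estimate
    TendstoInMeasure μ (fun (n : ℕ) ω =>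
        |WeightedU.bootstrapVar
            (fun y => (WeightedU.sigma μ (a n) (h n) (X n))⁻¹ * WeightedU.uStat (a n) (h n) y)
            (fun i => X n i ω) -
          variance (fun ω' => (WeightedU.sigma μ (a n) (h n) (X n))⁻¹ *
            WeightedU.U (a n) (h n) (X n) ω') μ|) atTop (fun _ => (0 : ℝ)) := by
  obtain ⟨Q, hQ, hs⟩ := WeightedU.exists_forall_isSample hX hindep hident
  have hM0 : ∀ n, 0 ≤ M n := fun n => (hM n).le
  have h4 := WeightedU.eventually_memLp_four_and_integral_le hs hh hM0 hmoment
  obtain ⟨B, hB⟩ := WeightedU.exists_eventually_secondMomentBound hs hh hmises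
  have hh2 := hB.mono fun n hB => hB.memLp_pi
  have hVσ := hh2.mono fun n hh2 => (hs n).V_le_sigma_sq (hh n) hh2 (a n)
  have hσ := (hV.and hVσ).mono fun n hn => sq_pos_iff.1 (hn.1.trans_le hn.2)
  have hρ := WeightedU.tendsto_remainderFactor_mul hV hVσ
    (fun n => integral_nonneg fun z : Fin (d + 1) → S => sq_nonneg (h n z))
    (h4.mono fun n hn => WeightedU.integral_sq_le_rpow_half hn.1 hn.2) hclt1
  have hv := WeightedU.tendsto_V_div_sigma_sq hs hh hh2 hσ hρ
  have hL := WeightedU.tendsto_lyapunovSum_four (fun n => Real.sqrt_nonneg _) hV hVσ hM0 hclt2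
  have havg := WeightedU.tendstoInMeasure_normAvg hs hh hM0 h4 hv hL
  have hsum := WeightedU.tendstoInMeasure_sum_sum_projSum_sq hs hh hh2 hv
  have hboot := WeightedU.tendstoInMeasure_bootstrapVar hs hh hB hρ hv hA havg
  refine ⟨?_, ?_, WeightedU.tendsto_avgWeight_mul_heterogeneity hs hh hA,
    WeightedU.tendstoInMeasure_abs_sub hboot
      (hσ.mono fun n => WeightedU.variance_inv_sigma_mul_U)⟩
  · simpa only [(hs _).h1_eq (hh _), WeightedU.normAvg_eq] using havg
  · simpa only [(hs _).h1_eq (hh _)] using hsum
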